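/- For a function $f:\{1,2,3,\dots\}\to\mathbb C$, a real number $x\ge 1$, a positive integer $q$ and an integer $a$, let $$\Delta(f,x;q,a)=\sum_{\substack{n\le x\\ n\equiv a\ (\mathrm{mod}\ q)}} f(n)-\frac1{\varphi(q)}\sum_{\substack{n\le x\\ (n,q)=1}}f(n),$$ and for real $Q>0$ write $q\sim Q$ for the integers $q$ with $Q<q\le 2Q$. Let $\pi(x)$ be the number of primes $p\le x$. There exist an absolute constant $c>0$, a real number $T$ and a function $\eta:\mathbb R\to\mathbb R$ with $\eta(t)\to0$ as $t\to\infty$ such that the following holds. Let $g$ be a complex-valued multiplicative function with $|g(n)|\le 1$ for all $n$, and let $0<Q\le x$ be real numbers with $Q\ge T$ and $x/Q\ge T$. Then there exist a set $\mathcal P$ of primes in $(x/2,x]$, containing all but at most a proportion $\eta(\min(Q,x/Q))$ of the primes in $(x/2,x]$, i.e. $$\#\mathcal P\ \ge\ \bigl(1-\eta(\min(Q,x/Q))\bigr)\,\#\{p\in(x/2,x]:\ p\text{ prime}\},$$ and a constant $\sigma\in\{-1,1\}$, such that every function $f$ with $$f(n)=g(n)\ \text{ for all } n\le x \text{ with }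 n\notin\mathcal P,\qquad f(p)=\sigma\ \text{ for all } p\in\mathcal P \tag{$*$}$$ satisfies $$|\Delta(f,x;q,1)|\ \ge\ c\,\frac{\pi(x)}{\varphi(q)}\quad\text{for at least half of the integers } q\sim Q,$$ and consequently $$\sum_{q\sim Q}|\Delta(f,x;q,1)|\ \ge\ c\,\frac{x}{\log x}.$$ Moreover there is a multiplicative function $f$ with $|f(n)|\le1$ for all $n$ which satisfies $(*)$. -/

import Mathlib

open Filter Topology

/-- The integers `q ∼ Q`, that is, `Q < q ≤ 2 * Q` (for a real number `Q ≥ 0`). -/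
noncomputable def dyadicModuli (Q : ℝ) : Finset ℕ :=
  Finset.Ioc ⌊Q⌋₊ ⌊2 * Q⌋₊

/-- The primes in the interval `(x / 2, x]` (for a real number `x ≥ 0`). -/
noncomputable def upperHalfPrimes (x : ℝ) : Finset ℕ :=
  (Finset.Ioc ⌊x / 2⌋₊ ⌊x⌋₊).filter Nat.Prime

/-- `Δ(f, x; q, a)`: the sum of `f n` over `1 ≤ n ≤ x` with `n ≡ a (mod q)`, minus `1 / φ(q)` times
the sum of `f n` over `1 ≤ n ≤ x` with `(n, q) = 1`. -/
noncomputable def Delta (f : ℕ → ℂ) (x : ℝ) (q : ℕ) (a : ℤ) : ℂ :=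
  (∑ n ∈ (Finset.Icc 1 ⌊x⌋₊).filter (fun n : ℕ => (n : ℤ) ≡ a [ZMOD (q : ℤ)]), f n)
    - 1 / (Nat.totient q : ℂ) *
      ∑ n ∈ (Finset.Icc 1 ⌊x⌋₊).filter (fun n : ℕ => Nat.Coprime n q), f n

/-- Up to `x`, the sequence `f` is `g` redefined to take the constant value `σ` on `P`. -/
def AgreesExceptOn (f g : ℕ → ℂ) (x : ℝ) (P : Finset ℕ) (σ : ℂ) : Prop :=
  (∀ n : ℕ, 1 ≤ n → (n : ℝ) ≤ x → n ∉ P → f n = g n) ∧ ∀ p ∈ P, f p = σ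

/-! Let P consist of the primes p in (x/2, x] such that p - 1 has no divisor q ~ Q. For q ~ Q no
element of P is 1 mod q, while all of them are coprime to q (they exceed q), so Δ(1_P, x; q, 1) =
-|P|/φ(q) exactly. For f satisfying the agreement condition, Δ(f) = A_q + σ B_q with B_q = Δ(1_P).
Since 2B = (A + B) - (A - B), for each q at least one sign gives |A_q + σ B_q| ≥ |B_q|, and by
pigeonhole one sign serves at least half of the q. Given Chebyshev's bounds, what remains is that P
contains almost all primes of (x/2, x].

This is Erdős's multiplication table argument for shifted primes (`card_primesPredDvd_le`). Fix a
finite set S of primes with L = ∑ 1/p large, and let M be their product. A typical p - 1 has about L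
prime divisors in S, but a typical product d * m has about 2L. Cut at 3L/2: either p - 1 has more
than 3L/2 divisors in S, or p - 1 = d * m is a product with unusually few. Both events depend only
on residues mod M, and exponential moments bound their densities by a constant times exp(-L/20)
(`card_residues_many_le`, `card_residue_pairs_few_le`). The Brun–Titchmarsh inequality
(`card_primes_modEq_le`) transfers these densities to primes modulo M and modulo d * M, provided d
is at most about √x. If q is larger than that, its cofactor (p - 1)/q is used instead.

Brun–Titchmarsh comes from a large sieve with Ramanujan sums, and the lower Chebyshev bound from the
central binomial coefficient. -/

/-! ### Ramanujan sums and their near-orthogonality along a progression -/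

open ArithmeticFunction in
theorem sum_divisors_moebius (n : ℕ) :
    ∑ t ∈ n.divisors, (moebius t : ℝ) = if n = 1 then 1 else 0 := by
  have h := congrArg (fun f : ArithmeticFunction ℤ => f n) coe_zeta_mul_moebius
  simp only [coe_zeta_mul_apply, one_apply] at h
  exact_mod_cast h

open ArithmeticFunction in
theorem sum_divisors_moebius_div_of_dvd {l e : ℕ} (hl : l ≠ 0) (he : e ∣ l) :
    ∑ d ∈ l.divisors, (if e ∣ d then (moebius (l / d) : ℝ) else 0) = if e = l then 1 else 0 := by
  rw [← Nat.sum_div_divisors l]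
  have he0 : 0 < e := Nat.pos_of_dvd_of_pos he (Nat.pos_of_ne_zero hl)
  have h1 : (l / e).divisors = l.divisors.filter (fun d => e ∣ l / d) := by
    ext d
    simp only [Nat.mem_divisors, Finset.mem_filter]
    constructor
    · rintro ⟨h, -⟩
      have hd : d * e ∣ l := by
        rw [mul_comm]
        exact (Nat.dvd_div_iff_mul_dvd he).1 h
      have : d ∣ l := (Dvd.intro _ rfl).trans hd
      exact ⟨⟨this, hl⟩, (Nat.dvd_div_iff_mul_dvd this).2 hd⟩
    · rintro ⟨⟨h, -⟩, h2⟩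
      refine ⟨(Nat.dvd_div_iff_mul_dvd he).2 ?_, (Nat.div_pos (Nat.le_of_dvd
        (Nat.pos_of_ne_zero hl) he) he0).ne'⟩
      rw [mul_comm]
      exact (Nat.dvd_div_iff_mul_dvd h).1 h2
  have h2 : (if e = l then (1 : ℝ) else 0) = if l / e = 1 then 1 else 0 := by
    obtain ⟨k, rfl⟩ := he
    have : e * k / e = k := Nat.mul_div_cancel_left k he0
    rw [this]
    congr 1
    simp [he0.ne']
  rw [h2, ← sum_divisors_moebius, h1, Finset.sum_filter]
  refine Finset.sum_congr rfl fun d hd => ?_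
  rw [Nat.div_div_self (Nat.dvd_of_mem_divisors hd) hl]

-- Write gcd(d, e) as the sum of φ(t) over common divisors t; Möbius inversion in d forces t = l,
-- and in e forces t = m. This is the exact orthogonality relation of Ramanujan sums.
open ArithmeticFunction in
theorem sum_gcd_mul_moebius {l m : ℕ} (hl : l ≠ 0) (hm : m ≠ 0) :
    ∑ d ∈ l.divisors, ∑ e ∈ m.divisors,
      (Nat.gcd d e : ℝ) * (moebius (l / d) * moebius (m / e)) =
      if l = m then (Nat.totient l : ℝ) else 0 := by
  have h1 : ∀ d ∈ l.divisors, ∀ e ∈ m.divisors, (Nat.gcd d e : ℝ) =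
      ∑ t ∈ l.divisors, (Nat.totient t : ℝ) * ((if t ∣ d then 1 else 0) *
        (if t ∣ e then 1 else 0)) := by
    intro d hd e he
    conv_lhs => rw [← Nat.sum_totient (Nat.gcd d e)]
    have : (Nat.gcd d e).divisors = l.divisors.filter (fun t => t ∣ d ∧ t ∣ e) := by
      ext t
      simp only [Nat.mem_divisors, Finset.mem_filter] at *
      refine ⟨fun h => ⟨⟨(h.1.trans (Nat.gcd_dvd_left d e)).trans hd.1, hl⟩,
        h.1.trans (Nat.gcd_dvd_left d e), h.1.trans (Nat.gcd_dvd_right d e)⟩,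
        fun h => ⟨Nat.dvd_gcd h.2.1 h.2.2, ?_⟩⟩
      exact Nat.gcd_ne_zero_left fun h0 => by simp [h0] at hd
    rw [this, Nat.cast_sum, Finset.sum_filter]
    refine Finset.sum_congr rfl fun t _ => ?_
    by_cases h1 : t ∣ d <;> by_cases h2 : t ∣ e <;> simp [h1, h2]
  have h2 : ∑ d ∈ l.divisors, ∑ e ∈ m.divisors,
      (Nat.gcd d e : ℝ) * (moebius (l / d) * moebius (m / e)) =
      ∑ t ∈ l.divisors, (Nat.totient t : ℝ) *
        ((∑ d ∈ l.divisors, if t ∣ d then (moebius (l / d) : ℝ) else 0) *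
        (∑ e ∈ m.divisors, if t ∣ e then (moebius (m / e) : ℝ) else 0)) := by
    simp_rw [Finset.sum_mul_sum, Finset.mul_sum]
    rw [Finset.sum_comm]
    refine (Finset.sum_congr rfl fun e he => Finset.sum_congr rfl fun d hd => by
      rw [h1 d hd e he, Finset.sum_mul]).trans ?_
    rw [Finset.sum_comm]
    refine (Finset.sum_congr rfl fun d hd => Finset.sum_comm).trans ?_
    rw [Finset.sum_comm]
    refine Finset.sum_congr rfl fun t _ => Finset.sum_congr rfl fun d _ =>
      Finset.sum_congr rfl fun e _ => ?_
    by_cases h1 : t ∣ d <;> by_cases h2 : t ∣ e <;> simp [h1, h2]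
  rw [h2]
  have h3 : ∀ t ∈ l.divisors, (∑ d ∈ l.divisors, if t ∣ d then (moebius (l / d) : ℝ) else 0) =
      if t = l then 1 else 0 := fun t ht =>
    sum_divisors_moebius_div_of_dvd hl (Nat.dvd_of_mem_divisors ht)
  rw [Finset.sum_congr rfl fun t ht => by rw [h3 t ht]]
  rw [Finset.sum_eq_single l]
  · by_cases h : l ∣ m
    · rw [sum_divisors_moebius_div_of_dvd hm h]
      simp
    · have h4 : l ≠ m := fun h5 => h (h5 ▸ dvd_rfl)
      have h5 : (∑ e ∈ m.divisors, if l ∣ e then (moebius (m / e) : ℝ) else 0) = 0 :=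
        Finset.sum_eq_zero fun e he =>
          if_neg fun h6 => h (h6.trans (Nat.dvd_of_mem_divisors he))
      simp [h5, h4]
  · intro t _ ht
    simp [ht]
  · intro h
    simp [hl] at h

/-- The Ramanujan sum `c_l(n)`. -/
noncomputable def ramanujanSum (l n : ℕ) : ℝ :=
  ∑ d ∈ l.divisors, (if d ∣ n then (d : ℝ) else 0) * ArithmeticFunction.moebius (l / d)

theorem ramanujanSum_of_coprime {l n : ℕ} (hl : l ≠ 0) (h : Nat.Coprime n l) :
    ramanujanSum l n = ArithmeticFunction.moebius l := by
  rw [ramanujanSum, Finset.sum_eq_single 1]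
  · simp
  · intro d hd hd1
    rw [if_neg, zero_mul]
    intro h2
    exact hd1 (Nat.eq_one_of_dvd_coprimes h h2 (Nat.dvd_of_mem_divisors hd))
  · simp [hl]

theorem abs_card_modEq_sub_le (K v : ℕ) {d : ℕ} (hd : 0 < d) :
    |(((Finset.range K).filter (fun k => k ≡ v [MOD d])).card : ℝ) - K / d| ≤ 1 := by
  have h := Nat.count_modEq_card K hd v
  rw [Nat.count_eq_card_filter_range] at h
  rw [h]
  have hd' : (0 : ℝ) < d := by exact_mod_cast hd
  have h1 : ((K / d : ℕ) : ℝ) ≤ K / d := Nat.cast_div_le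
  have h2 : (K : ℝ) / d < (K / d : ℕ) + 1 := by
    rw [div_lt_iff₀ hd']
    have := Nat.lt_mul_div_succ K hd
    rw [mul_comm] at this
    exact_mod_cast this
  split_ifs <;> push_cast <;> rw [abs_le] <;> constructor <;> linarith

theorem exists_modEq_iff_dvd {q d : ℕ} (h : Nat.Coprime d q) (hd : 0 < d) (r : ℕ) :
    ∃ v, ∀ k, d ∣ r + q * k ↔ k ≡ v [MOD d] := by
  have : NeZero d := ⟨hd.ne'⟩
  have hu : IsUnit (q : ZMod d) := (ZMod.isUnit_iff_coprime q d).2 h.symm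
  refine ⟨(-(r : ZMod d) * (q : ZMod d)⁻¹).val, fun k => ?_⟩
  rw [← ZMod.natCast_eq_natCast_iff, ← ZMod.natCast_eq_zero_iff]
  push_cast
  rw [ZMod.natCast_val, ZMod.cast_id]
  have h1 : (q : ZMod d) * (q : ZMod d)⁻¹ = 1 := ZMod.mul_inv_of_unit _ hu
  constructor
  · intro h2
    linear_combination (-(k : ZMod d)) * h1 + (q : ZMod d)⁻¹ * h2
  · intro h2
    rw [h2]
    linear_combination (-(r : ZMod d)) * h1

theorem abs_card_dvd_sub_le (K r : ℕ) {q d : ℕ} (h : Nat.Coprime d q) (hd : 0 < d) :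
    |(((Finset.range K).filter (fun k => d ∣ r + q * k)).card : ℝ) - K / d| ≤ 1 := by
  obtain ⟨v, hv⟩ := exists_modEq_iff_dvd h hd r
  simp_rw [hv]
  exact abs_card_modEq_sub_le K v hd

theorem abs_moebius_le_one_real (n : ℕ) : |(ArithmeticFunction.moebius n : ℝ)| ≤ 1 := by
  exact_mod_cast ArithmeticFunction.abs_moebius_le_one (n := n)

theorem sum_divisors_cast_le (l : ℕ) : ∑ d ∈ l.divisors, (d : ℝ) ≤ (l : ℝ) ^ 2 := by
  calc ∑ d ∈ l.divisors, (d : ℝ) ≤ ∑ _d ∈ l.divisors, (l : ℝ) :=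
        Finset.sum_le_sum fun d hd => by exact_mod_cast Nat.divisor_le hd
    _ = l.divisors.card * (l : ℝ) := by simp
    _ ≤ l * l := by
        have : (l.divisors.card : ℝ) ≤ l := by exact_mod_cast Nat.card_divisors_le_self l
        gcongr
    _ = (l : ℝ) ^ 2 := by ring

/-- After expanding, the pair (d, e) counts the k with lcm(d, e) ∣ r + q * k. As the lcm is coprime
to q, this count is K / lcm(d, e) up to 1. Since d * e / lcm = gcd, the main terms are those of
`sum_gcd_mul_moebius`, and the errors are at most ∑ d * ∑ e. -/
theorem abs_sum_ramanujanSum_mul_sub_le (K r : ℕ) {q l m : ℕ} (hl : l ≠ 0) (hm : m ≠ 0)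
    (hlq : Nat.Coprime l q) (hmq : Nat.Coprime m q) :
    |∑ k ∈ Finset.range K, ramanujanSum l (r + q * k) * ramanujanSum m (r + q * k) -
      K * (if l = m then (Nat.totient l : ℝ) else 0)| ≤ (l : ℝ) ^ 2 * (m : ℝ) ^ 2 := by
  let N : ℕ → ℕ → ℝ := fun d e =>
    (((Finset.range K).filter (fun k => Nat.lcm d e ∣ r + q * k)).card : ℝ)
  have h1 : ∑ k ∈ Finset.range K, ramanujanSum l (r + q * k) * ramanujanSum m (r + q * k) =
      ∑ d ∈ l.divisors, ∑ e ∈ m.divisors, (d * e * N d e : ℝ) *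
        (ArithmeticFunction.moebius (l / d) * ArithmeticFunction.moebius (m / e)) := by
    simp_rw [ramanujanSum, Finset.sum_mul_sum]
    rw [Finset.sum_comm]
    refine Finset.sum_congr rfl fun d _ => ?_
    rw [Finset.sum_comm]
    refine Finset.sum_congr rfl fun e _ => ?_
    have : N d e = ∑ k ∈ Finset.range K, if Nat.lcm d e ∣ r + q * k then (1 : ℝ) else 0 := by
      simp [N]
    rw [this, Finset.mul_sum, Finset.sum_mul]
    refine Finset.sum_congr rfl fun k _ => ?_
    simp_rw [Nat.lcm_dvd_iff]
    by_cases h1 : d ∣ r + q * k <;> by_cases h2 : e ∣ r + q * k <;> simp [h1, h2]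
    ring
  rw [h1, ← sum_gcd_mul_moebius hl hm]
  simp_rw [Finset.mul_sum, ← Finset.sum_sub_distrib]
  calc _ ≤ ∑ d ∈ l.divisors, ∑ e ∈ m.divisors, (d : ℝ) * e := by
        refine (Finset.abs_sum_le_sum_abs _ _).trans (Finset.sum_le_sum fun d hd => ?_)
        refine (Finset.abs_sum_le_sum_abs _ _).trans (Finset.sum_le_sum fun e he => ?_)
        have hd0 : 0 < d := Nat.pos_of_mem_divisors hd
        have he0 : 0 < e := Nat.pos_of_mem_divisors he
        have hc : Nat.Coprime (Nat.lcm d e) q :=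
          Nat.Coprime.coprime_dvd_left (Nat.lcm_dvd_mul d e)
            (Nat.Coprime.mul_left (hlq.coprime_dvd_left (Nat.dvd_of_mem_divisors hd))
              (hmq.coprime_dvd_left (Nat.dvd_of_mem_divisors he)))
        have h0 : 0 < Nat.lcm d e := Nat.lcm_pos hd0 he0
        have h2 := abs_card_dvd_sub_le K r hc h0
        have h3 : (Nat.gcd d e : ℝ) = d * e / Nat.lcm d e := by
          rw [eq_div_iff (by exact_mod_cast h0.ne')]
          exact_mod_cast Nat.gcd_mul_lcm d e
        have h4 : (d * e * N d e : ℝ) *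
            (ArithmeticFunction.moebius (l / d) * ArithmeticFunction.moebius (m / e)) -
            K * ((Nat.gcd d e : ℝ) *
            (ArithmeticFunction.moebius (l / d) * ArithmeticFunction.moebius (m / e))) =
            (d * e : ℝ) * (N d e - K / Nat.lcm d e) *
            (ArithmeticFunction.moebius (l / d) * ArithmeticFunction.moebius (m / e)) := by
          rw [h3]; ring
        rw [h4, abs_mul, abs_mul, abs_mul (ArithmeticFunction.moebius (l / d) : ℝ),
          abs_of_nonneg (show (0 : ℝ) ≤ d * e by positivity)]
        have h5 := abs_moebius_le_one_real (l / d)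
        have h6 := abs_moebius_le_one_real (m / e)
        calc _ ≤ (d * e : ℝ) * 1 * (1 * 1) := by gcongr
          _ = _ := by ring
    _ = (∑ d ∈ l.divisors, (d : ℝ)) * ∑ e ∈ m.divisors, (e : ℝ) := by
        rw [Finset.sum_mul_sum]
    _ ≤ _ := by
        gcongr
        · exact sum_divisors_cast_le l
        · exact sum_divisors_cast_le m

/-! ### The sieve bound for a progression -/

/-- The squarefree integers up to `z` that are coprime to `q`. -/
def squarefreeCoprime (z q : ℕ) : Finset ℕ :=
  (Finset.Icc 1 z).filter (fun l => Squarefree l ∧ Nat.Coprime l q)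

/-- The upper bound sieve in an arithmetic progression, in the form of a dual large sieve. -/
theorem card_sifted_mul_sq_le (K r q z : ℕ) :
    (((Finset.range K).filter
      (fun k => ∀ l ∈ Finset.Icc 1 z, Nat.Coprime (r + q * k) l)).card : ℝ) *
      (∑ l ∈ squarefreeCoprime z q, (1 : ℝ) / Nat.totient l) ^ 2 ≤
    K * (∑ l ∈ squarefreeCoprime z q, (1 : ℝ) / Nat.totient l) + (z : ℝ) ^ 6 := by
  set L := squarefreeCoprime z q with hL
  set S := ∑ l ∈ L, (1 : ℝ) / Nat.totient l with hS
  -- With these weights `F` is constantly `S` on the sifted set, because c_l = μ(l) there, while the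
  -- diagonal of the second moment is K ∑ w(l)² φ(l) = K S.
  let w : ℕ → ℝ := fun l => ArithmeticFunction.moebius l / Nat.totient l
  let F : ℕ → ℝ := fun k => ∑ l ∈ L, w l * ramanujanSum l (r + q * k)
  have hmem : ∀ l ∈ L, (1 ≤ l ∧ l ≤ z) ∧ Squarefree l ∧ Nat.Coprime l q := by
    intro l hl
    simpa [hL, squarefreeCoprime] using hl
  have hwabs : ∀ l ∈ L, |w l| ≤ 1 := by
    intro l hl
    have : (1 : ℝ) ≤ Nat.totient l := by
      exact_mod_cast Nat.totient_pos.2 (hmem l hl).1.1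
    simp only [w]
    rw [abs_div, abs_of_nonneg (by positivity : (0 : ℝ) ≤ Nat.totient l)]
    rw [div_le_one (by positivity)]
    exact (abs_moebius_le_one_real l).trans this
  have hwsq : ∀ l ∈ L, w l * ArithmeticFunction.moebius l = 1 / Nat.totient l := by
    intro l hl
    have h1 : (ArithmeticFunction.moebius l : ℝ) ^ 2 = 1 := by
      exact_mod_cast ArithmeticFunction.moebius_sq_eq_one_of_squarefree (hmem l hl).2.1
    simp only [w]
    rw [div_mul_eq_mul_div, ← sq, h1]
  have hF : ∀ k ∈ (Finset.range K).filter
      (fun k => ∀ l ∈ Finset.Icc 1 z, Nat.Coprime (r + q * k) l), F k = S := by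
    intro k hk
    refine Finset.sum_congr rfl fun l hl => ?_
    have h1 := hmem l hl
    rw [ramanujanSum_of_coprime (by omega)
      ((Finset.mem_filter.1 hk).2 l (Finset.mem_Icc.2 h1.1)), hwsq l hl]
  have h1 : (((Finset.range K).filter
      (fun k => ∀ l ∈ Finset.Icc 1 z, Nat.Coprime (r + q * k) l)).card : ℝ) * S ^ 2 ≤
      ∑ k ∈ Finset.range K, F k ^ 2 := by
    rw [← nsmul_eq_mul, ← Finset.sum_const, 
      ← Finset.sum_congr rfl fun k hk => congrArg (· ^ 2) (hF k hk)]
    exact Finset.sum_le_sum_of_subset_of_nonneg (Finset.filter_subset _ _)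
      fun _ _ _ => sq_nonneg _
  have h2 : ∑ k ∈ Finset.range K, F k ^ 2 = ∑ l ∈ L, ∑ m ∈ L, w l * w m *
      ∑ k ∈ Finset.range K, ramanujanSum l (r + q * k) * ramanujanSum m (r + q * k) := by
    simp_rw [F, sq, Finset.sum_mul_sum, Finset.mul_sum]
    rw [Finset.sum_comm]
    refine Finset.sum_congr rfl fun l _ => ?_
    rw [Finset.sum_comm]
    refine Finset.sum_congr rfl fun m _ => Finset.sum_congr rfl fun k _ => ?_
    ring
  have h3 : ∑ l ∈ L, ∑ m ∈ L, w l * w m * (K * (if l = m then (Nat.totient l : ℝ) else 0)) =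
      K * S := by
    rw [hS, Finset.mul_sum]
    refine Finset.sum_congr rfl fun l hl => ?_
    rw [Finset.sum_eq_single l]
    · have h4 : (0 : ℝ) < Nat.totient l := by
        exact_mod_cast Nat.totient_pos.2 (hmem l hl).1.1
      have h5 := hwsq l hl
      rw [if_pos rfl]
      have h6 : (ArithmeticFunction.moebius l : ℝ) = w l * Nat.totient l := by
        simp only [w]; field_simp
      rw [h6] at h5
      calc _ = (K : ℝ) * (w l * (w l * Nat.totient l)) := by ring
        _ = _ := by rw [h5]
    · intro m _ hm
      simp [hm.symm]
    · intro h; exact absurd hl h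
  have hcard : (L.card : ℝ) ≤ z := by
    have : L.card ≤ (Finset.Icc 1 z).card := Finset.card_filter_le _ _
    exact_mod_cast this.trans (by simp)
  have h4 : |∑ k ∈ Finset.range K, F k ^ 2 - K * S| ≤ (z : ℝ) ^ 6 := by
    rw [h2, ← h3]
    simp_rw [← Finset.sum_sub_distrib, ← mul_sub]
    -- At most z² pairs, each with error at most l² m² ≤ z⁴.
    calc _ ≤ ∑ l ∈ L, ∑ m ∈ L, (z : ℝ) ^ 4 := by
          refine (Finset.abs_sum_le_sum_abs _ _).trans (Finset.sum_le_sum fun l hl => ?_)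
          refine (Finset.abs_sum_le_sum_abs _ _).trans (Finset.sum_le_sum fun m hm => ?_)
          have hl' := hmem l hl
          have hm' := hmem m hm
          have hlz : (l : ℝ) ≤ z := by exact_mod_cast hl'.1.2
          have hmz : (m : ℝ) ≤ z := by exact_mod_cast hm'.1.2
          have h5 := abs_sum_ramanujanSum_mul_sub_le K r (q := q) (l := l) (m := m)
            (by omega) (by omega) hl'.2.2 hm'.2.2
          rw [abs_mul, abs_mul]
          have h6 := hwabs l hl
          have h7 := hwabs m hm
          calc _ ≤ 1 * 1 * ((z : ℝ) ^ 2 * (z : ℝ) ^ 2) := by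
                gcongr
                exact h5.trans (by gcongr)
            _ = _ := by ring
      _ = (L.card : ℝ) * (L.card * (z : ℝ) ^ 4) := by simp
      _ ≤ z * (z * (z : ℝ) ^ 4) := by gcongr
      _ = _ := by ring
  have h5 := (abs_le.1 h4).2
  linarith

/-! ### Lower bound for the sieve denominator -/

theorem sum_le_sum_of_forall_exists {ι κ : Type*} [DecidableEq ι] {s : Finset ι} {t : Finset κ}
    {f : ι → ℝ} {h : κ → ℝ} (φ : κ → ι) (hf : ∀ i, 0 ≤ f i) (hh : ∀ k ∈ t, f (φ k) ≤ h k)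
    (hs : ∀ i ∈ s, ∃ k ∈ t, φ k = i) : ∑ i ∈ s, f i ≤ ∑ k ∈ t, h k := by
  calc ∑ i ∈ s, f i ≤ ∑ i ∈ t.image φ, f i :=
        Finset.sum_le_sum_of_subset_of_nonneg
          (fun i hi => Finset.mem_image.2 (by simpa using hs i hi)) fun _ _ _ => hf _
    _ ≤ ∑ k ∈ t, f (φ k) := Finset.sum_image_le_of_nonneg fun _ _ => hf _
    _ ≤ _ := Finset.sum_le_sum hh

theorem sum_Icc_inv_sq_le (z : ℕ) : ∑ a ∈ Finset.Icc 1 z, (1 : ℝ) / (a : ℝ) ^ 2 ≤ 2 := by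
  rcases Nat.eq_zero_or_pos z with rfl | hz
  · simp
  · have h := sum_Ioc_inv_sq_le_sub (α := ℝ) (k := 1) (n := z) one_ne_zero hz
    have h1 : Finset.Icc 1 z = insert 1 (Finset.Ioc 1 z) := by
      ext a; simp; omega
    rw [h1, Finset.sum_insert (by simp)]
    have h2 : (0 : ℝ) ≤ (z : ℝ)⁻¹ := by positivity
    simp only [one_div, Nat.cast_one, one_pow, inv_one] at *
    linarith

theorem log_le_sum_Icc_one_div (z : ℕ) :
    Real.log ((z : ℝ) + 1) ≤ ∑ n ∈ Finset.Icc 1 z, (1 : ℝ) / n := by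
  have h := log_add_one_le_harmonic z
  rw [harmonic_eq_sum_Icc] at h
  push_cast at h
  simpa using h

theorem sum_Icc_one_div_le_log (z : ℕ) :
    ∑ n ∈ Finset.Icc 1 z, (1 : ℝ) / n ≤ 1 + Real.log z := by
  have h := harmonic_le_one_add_log z
  rw [harmonic_eq_sum_Icc] at h
  push_cast at h
  simpa using h

theorem one_add_inv_le_inv_one_sub_inv {p : ℕ} (hp : p.Prime) :
    0 < 1 - (p : ℝ)⁻¹ ∧ 1 + (p : ℝ)⁻¹ ≤ (1 - (p : ℝ)⁻¹)⁻¹ := by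
  have h2 : (2 : ℝ) ≤ p := by exact_mod_cast hp.two_le
  have h3 : (p : ℝ)⁻¹ ≤ 1 / 2 := by
    rw [inv_eq_one_div]; gcongr
  have h4 : (0 : ℝ) < (p : ℝ)⁻¹ := by positivity
  have h5 : 0 < 1 - (p : ℝ)⁻¹ := by linarith
  refine ⟨h5, ?_⟩
  rw [le_inv_comm₀ (by positivity) h5, inv_eq_one_div (1 + (p : ℝ)⁻¹),
    le_div_iff₀ (by positivity)]
  nlinarith

theorem cast_totient_eq (n : ℕ) :
    (Nat.totient n : ℝ) = n * ∏ p ∈ n.primeFactors, (1 - (p : ℝ)⁻¹) := by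
  have h := congrArg (fun t : ℚ => (t : ℝ)) (Nat.totient_eq_mul_prod_factors n)
  push_cast at h
  exact h

/-- Each squarefree divisor is the product of a subset of the prime factors. -/
theorem sum_squarefree_divisors_inv {q : ℕ} (hq : q ≠ 0) :
    ∑ e ∈ q.divisors.filter Squarefree, (1 : ℝ) / e = ∏ p ∈ q.primeFactors, (1 + (p : ℝ)⁻¹) := by
  rw [Finset.prod_one_add, Nat.sum_divisors_filter_squarefree hq]
  have h1 : (UniqueFactorizationMonoid.normalizedFactors q).toFinset = q.primeFactors := by
    rw [Nat.factors_eq]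
    ext p; simp
  rw [h1]
  refine Finset.sum_congr rfl fun t ht => ?_
  have h2 : t.val.prod = ∏ p ∈ t, p := by rw [Finset.prod, Multiset.map_id']
  rw [h2]
  push_cast
  rw [one_div, Finset.prod_inv_distrib]

theorem sum_squarefree_divisors_inv_le {q : ℕ} (hq : q ≠ 0) :
    ∑ e ∈ q.divisors.filter Squarefree, (1 : ℝ) / e ≤ q / Nat.totient q := by
  have hq' : (q : ℝ) ≠ 0 := by exact_mod_cast hq
  rw [sum_squarefree_divisors_inv hq, cast_totient_eq, ← div_div, div_self hq', one_div,
    ← Finset.prod_inv_distrib]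
  exact Finset.prod_le_prod (fun _ _ => by positivity) fun p hp =>
    (one_add_inv_le_inv_one_sub_inv (Nat.prime_of_mem_primeFactors hp)).2

/-- Every n ≤ z factors as a² * e * l with e a squarefree divisor of q and l squarefree and coprime
to q. So the harmonic sum is at most the product of three sums; the first is at most 2 and the
second at most q/φ(q). -/
theorem log_le_sum_squarefreeCoprime (z : ℕ) {q : ℕ} (hq : q ≠ 0) :
    Real.log ((z : ℝ) + 1) ≤
      2 * (q / Nat.totient q) * ∑ l ∈ squarefreeCoprime z q, (1 : ℝ) / Nat.totient l := by
  have h1 : ∑ n ∈ Finset.Icc 1 z, (1 : ℝ) / n ≤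
      ∑ t ∈ Finset.Icc 1 z ×ˢ (q.divisors.filter Squarefree) ×ˢ squarefreeCoprime z q,
        1 / (t.1 : ℝ) ^ 2 * (1 / (t.2.1 : ℝ) * (1 / (t.2.2 : ℝ))) := by
    refine sum_le_sum_of_forall_exists (f := fun n : ℕ => (1 : ℝ) / n)
      (fun t : ℕ × ℕ × ℕ => t.1 ^ 2 * (t.2.1 * t.2.2))
      (fun _ => by positivity) (fun t _ => ?_) ?_
    · push_cast
      rw [one_div_mul_one_div, one_div_mul_one_div]
    · intro n hn
      rw [Finset.mem_Icc] at hn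
      obtain ⟨b, a, hb, ha, hab, hsq⟩ := Nat.sq_mul_squarefree_of_pos (show 0 < n by omega)
      have hg0 : 0 < Nat.gcd b q := Nat.gcd_pos_of_pos_left _ hb
      have hmul : Nat.gcd b q * (b / Nat.gcd b q) = b := Nat.mul_div_cancel' (Nat.gcd_dvd_left b q)
      have hh0 : 0 < b / Nat.gcd b q := Nat.div_pos (Nat.le_of_dvd hb (Nat.gcd_dvd_left b q)) hg0
      have hsq' : Squarefree (Nat.gcd b q * (b / Nat.gcd b q)) := by rwa [hmul]
      have hcop : Nat.Coprime (b / Nat.gcd b q) q := by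
        rw [Nat.coprime_iff_gcd_eq_one]
        by_contra hne
        obtain ⟨p, hp, hpd⟩ := Nat.exists_prime_and_dvd hne
        have hp1 : p ∣ b / Nat.gcd b q := hpd.trans (Nat.gcd_dvd_left _ _)
        have hp2 : p ∣ q := hpd.trans (Nat.gcd_dvd_right _ _)
        have hp3 : p ∣ Nat.gcd b q :=
          Nat.dvd_gcd (hp1.trans (Nat.div_dvd_of_dvd (Nat.gcd_dvd_left b q))) hp2
        exact hp.not_isUnit (hsq' p (Nat.mul_dvd_mul hp3 hp1))
      refine ⟨(a, Nat.gcd b q, b / Nat.gcd b q), ?_, ?_⟩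
      · simp only [Finset.mem_product, Finset.mem_Icc, Finset.mem_filter, Nat.mem_divisors,
          squarefreeCoprime]
        have ha' : a ≤ n := by
          calc a ≤ a ^ 2 := Nat.le_self_pow (by norm_num) a
            _ ≤ a ^ 2 * b := Nat.le_mul_of_pos_right _ hb
            _ = n := hab
        have hb' : b ≤ n := by
          calc b ≤ a ^ 2 * b := Nat.le_mul_of_pos_left _ (by positivity)
            _ = n := hab
        refine ⟨⟨ha, ha'.trans hn.2⟩, ⟨⟨Nat.gcd_dvd_right b q, hq⟩,
          hsq.squarefree_of_dvd (Nat.gcd_dvd_left b q)⟩, ⟨hh0,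
          (Nat.div_le_self _ _).trans (hb'.trans hn.2)⟩,
          hsq.squarefree_of_dvd (Nat.div_dvd_of_dvd (Nat.gcd_dvd_left b q)), hcop⟩
      · simp only [hmul, hab]
  have h2 : ∑ l ∈ squarefreeCoprime z q, (1 : ℝ) / l ≤
      ∑ l ∈ squarefreeCoprime z q, (1 : ℝ) / Nat.totient l := by
    refine Finset.sum_le_sum fun l hl => ?_
    have hl1 : 0 < l := by
      have := (Finset.mem_Icc.1 (Finset.mem_filter.1 hl).1).1
      omega
    have : (0 : ℝ) < Nat.totient l := by exact_mod_cast Nat.totient_pos.2 hl1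
    gcongr
    exact Nat.totient_le l
  refine (log_le_sum_Icc_one_div z).trans (h1.trans ?_)
  rw [Finset.sum_product]
  simp_rw [Finset.sum_product, ← Finset.mul_sum, ← Finset.sum_mul]
  rw [mul_assoc 2]
  gcongr
  · exact sum_Icc_inv_sq_le z
  · exact sum_squarefree_divisors_inv_le hq

/-! ### The Brun–Titchmarsh inequality -/

theorem card_primes_modEq_le_add_card_sifted (z N r q : ℕ) :
    ((Finset.Icc 1 N).filter (fun p => p.Prime ∧ p ≡ r [MOD q])).card ≤
      z + ((Finset.range (N / q + 1)).filter
        (fun k => ∀ l ∈ Finset.Icc 1 z, Nat.Coprime (r % q + q * k) l)).card := by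
  classical
  have h1 : (Finset.Icc 1 N).filter (fun p => p.Prime ∧ p ≡ r [MOD q]) ⊆ Finset.Icc 1 z ∪
      ((Finset.range (N / q + 1)).filter
        (fun k => ∀ l ∈ Finset.Icc 1 z, Nat.Coprime (r % q + q * k) l)).image
          (fun k => r % q + q * k) := by
    intro p hp
    obtain ⟨hp1, hp2, hp3⟩ := Finset.mem_filter.1 hp
    rw [Finset.mem_Icc] at hp1
    by_cases hz : p ≤ z
    · exact Finset.mem_union_left _ (Finset.mem_Icc.2 ⟨hp1.1, hz⟩)
    · refine Finset.mem_union_right _ (Finset.mem_image.2 ⟨p / q, ?_, ?_⟩)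
      · have h4 : r % q + q * (p / q) = p := by
          rw [← hp3]
          exact Nat.mod_add_div p q
        rw [Finset.mem_filter, Finset.mem_range, Nat.lt_succ_iff, h4]
        refine ⟨Nat.div_le_div_right hp1.2, fun l hl => ?_⟩
        rw [Finset.mem_Icc] at hl
        exact (Nat.coprime_of_lt_prime (n := l) (by omega) (show l < p by omega) hp2)
      · rw [← hp3]
        exact Nat.mod_add_div p q
  refine (Finset.card_le_card h1).trans ((Finset.card_union_le _ _).trans ?_)
  exact Nat.add_le_add (by simp) Finset.card_image_le

/-- The Brun–Titchmarsh inequality, with an unspecified constant. -/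
theorem card_primes_modEq_le {q : ℕ} (r : ℕ) (hq : 0 < q) {x : ℝ} (hx : q < x) :
    (((Finset.Icc 1 ⌊x⌋₊).filter (fun p => p.Prime ∧ p ≡ r [MOD q])).card : ℝ) ≤
      100 * (x / (Nat.totient q * Real.log (x / q))) := by
  have hq' : (0 : ℝ) < q := by exact_mod_cast hq
  have hφ : (0 : ℝ) < Nat.totient q := by exact_mod_cast Nat.totient_pos.2 hq
  set X : ℝ := x / q with hX
  have hX1 : 1 < X := (one_lt_div hq').2 hx
  have hX0 : 0 < X := by linarith
  have hlog : 0 < Real.log X := Real.log_pos hX1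
  -- The sieve error is z ^ 6, so this level keeps it below √X, while log y is still a fixed
  -- fraction of log X.
  set y : ℝ := X ^ (1 / 12 : ℝ) with hy
  have hy1 : 1 ≤ y := Real.one_le_rpow hX1.le (by norm_num)
  have hy12 : y ^ 12 = X := by
    rw [hy, ← Real.rpow_natCast, ← Real.rpow_mul hX0.le]
    norm_num
  set z : ℕ := ⌊y⌋₊ with hz
  have hzy : (z : ℝ) ≤ y := Nat.floor_le (by linarith)
  have hyz : y < z + 1 := Nat.lt_floor_add_one y
  have hz1 : 1 ≤ z := Nat.le_floor (by simpa using hy1)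
  set S := ∑ l ∈ squarefreeCoprime z q, (1 : ℝ) / Nat.totient l with hS
  have hS1 : 1 ≤ S := by
    have h1 : 1 ∈ squarefreeCoprime z q := by simp [squarefreeCoprime, hz1]
    have := Finset.single_le_sum (f := fun l => (1 : ℝ) / Nat.totient l)
      (fun _ _ => by positivity) h1
    simpa [hS] using this
  have hSlog : Real.log X / 12 ≤ 2 * (q / Nat.totient q) * S := by
    refine le_trans ?_ (log_le_sum_squarefreeCoprime z hq.ne')
    rw [← hy12, Real.log_pow]
    have := Real.log_le_log (by linarith) hyz.le
    push_cast
    linarith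
  have h1 := card_primes_modEq_le_add_card_sifted z ⌊x⌋₊ r q
  have h2 := card_sifted_mul_sq_le (⌊x⌋₊ / q + 1) (r % q) q z
  rw [← hS] at h2
  set A := ((Finset.range (⌊x⌋₊ / q + 1)).filter
        (fun k => ∀ l ∈ Finset.Icc 1 z, Nat.Coprime (r % q + q * k) l)).card
  have h1' : (((Finset.Icc 1 ⌊x⌋₊).filter (fun p => p.Prime ∧ p ≡ r [MOD q])).card : ℝ) ≤ z + A := by
    exact_mod_cast h1
  -- The extra 1 is absorbed because X > 1.
  have hK : ((⌊x⌋₊ / q + 1 : ℕ) : ℝ) ≤ 2 * X := by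
    have h3 : ((⌊x⌋₊ / q : ℕ) : ℝ) ≤ X := by
      refine Nat.cast_div_le.trans ?_
      rw [hX]
      gcongr
      exact Nat.floor_le (by linarith)
    push_cast
    linarith
  have hz6 : (z : ℝ) ^ 6 ≤ y ^ 6 := by gcongr
  have hA : (A : ℝ) ≤ 2 * X / S + y ^ 6 := by
    have h3 : (A : ℝ) * S ^ 2 ≤ 2 * X * S + y ^ 6 := by
      have : ((⌊x⌋₊ / q + 1 : ℕ) : ℝ) * S ≤ 2 * X * S := by gcongr
      linarith
    have h4 : (A : ℝ) ≤ (2 * X * S + y ^ 6) / S ^ 2 := by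
      rwa [le_div_iff₀ (by positivity)]
    refine h4.trans ?_
    rw [add_div]
    have h5 : 2 * X * S / S ^ 2 = 2 * X / S := by
      field_simp
    rw [h5]
    gcongr
    exact div_le_self (by positivity) (one_le_pow₀ hS1)
  have hSinv : 2 * X / S ≤ 48 * (x / (Nat.totient q * Real.log X)) := by
    rw [div_le_iff₀ (by linarith)]
    have h6 : x = X * q := by rw [hX]; field_simp
    rw [h6]
    have h7 : 48 * (X * q / (Nat.totient q * Real.log X)) * S =
        (2 * (q / Nat.totient q) * S) * (24 * X / Real.log X) := by
      field_simp
      ring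
    rw [h7]
    calc 2 * X = Real.log X / 12 * (24 * X / Real.log X) := by field_simp; ring
      _ ≤ _ := by gcongr
  have hy6 : y ^ 6 ≤ 2 * (x / (Nat.totient q * Real.log X)) := by
    have h8 : Real.log X ≤ 2 * y ^ 6 := by
      have := Real.log_le_sub_one_of_pos (show 0 < y ^ 6 by positivity)
      have h9 : Real.log X = 2 * Real.log (y ^ 6) := by
        rw [← hy12, Real.log_pow, Real.log_pow]; push_cast; ring
      rw [h9]; linarith
    have h10 : X ≤ x / Nat.totient q := by
      rw [hX]
      have : (Nat.totient q : ℝ) ≤ q := by exact_mod_cast Nat.totient_le q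
      have hx0 : 0 < x := by linarith
      gcongr
    rw [← div_div]
    calc y ^ 6 ≤ 2 * (X / Real.log X) := by
          rw [← mul_div_assoc, le_div_iff₀ hlog]
          calc y ^ 6 * Real.log X ≤ y ^ 6 * (2 * y ^ 6) := by gcongr
            _ = 2 * y ^ 12 := by ring
            _ = 2 * X := by rw [hy12]
      _ ≤ _ := by gcongr
  have hzz : (z : ℝ) ≤ y ^ 6 := hzy.trans (le_self_pow₀ hy1 (by norm_num))
  have hpos : 0 ≤ x / (Nat.totient q * Real.log X) := by
    have hx0 : 0 < x := by linarith
    positivity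
  linarith

/-! ### Chebyshev bounds -/

/-- Erdős's proof of Bertrand's postulate, keeping the primes of (n, 2n]. Every prime power in the
factorization is at most 2n; primes above √(2n) occur at most once, those in (2n/3, n] not at all,
and the primorial bound handles the range up to 2n/3. -/
theorem centralBinom_le_pow_mul_pow_card_primes {n : ℕ} (hn : 2 < n) :
    Nat.centralBinom n ≤ (2 * n) ^ Nat.sqrt (2 * n) * 4 ^ (2 * n / 3) *
      (2 * n) ^ ((Finset.Ioc n (2 * n)).filter Nat.Prime).card := by
  have n2_pos : 1 ≤ 2 * n := by omega
  let f : ℕ → ℕ := fun p => p ^ n.centralBinom.factorization p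
  have hf : ∀ p, f p ≤ 2 * n := fun p => Nat.pow_factorization_choose_le (by omega)
  let R := (Finset.range (2 * n + 1)).filter Nat.Prime
  have h0 : ∏ p ∈ R, f p = n.centralBinom := by
    rw [← Nat.prod_pow_factorization_centralBinom n]
    refine Finset.prod_filter_of_ne fun p _ h => ?_
    contrapose h
    simp only [f]
    rw [Nat.factorization_eq_zero_of_not_prime n.centralBinom h, pow_zero]
  rw [← h0, ← Finset.prod_filter_mul_prod_filter_not R (· ≤ n)]
  refine mul_le_mul' ?_ ?_
  · rw [← Finset.prod_filter_mul_prod_filter_not _ (· ≤ Nat.sqrt (2 * n))]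
    refine mul_le_mul' ?_ ?_
    · refine (Finset.prod_le_prod' fun p _ => hf p).trans ?_
      rw [Finset.prod_const]
      refine pow_right_mono₀ n2_pos ?_
      have : (Finset.Icc 1 (Nat.sqrt (2 * n))).card = Nat.sqrt (2 * n) := by simp
      refine (Finset.card_le_card fun p hp => ?_).trans this.le
      simp only [R, Finset.mem_filter] at hp
      exact Finset.mem_Icc.2 ⟨hp.1.1.2.one_lt.le, hp.2⟩
    · refine le_trans ?_ (primorial_le_four_pow (2 * n / 3))
      rw [← Finset.prod_filter_mul_prod_filter_not _ (· ≤ 2 * n / 3)]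
      have h1 : ∏ p ∈ {p ∈ {p ∈ {p ∈ R | p ≤ n} | ¬p ≤ Nat.sqrt (2 * n)} | ¬p ≤ 2 * n / 3}, f p
          = 1 := by
        refine Finset.prod_eq_one fun p hp => ?_
        simp only [R, Finset.mem_filter] at hp
        simp only [f]
        rw [Nat.factorization_centralBinom_of_two_mul_self_lt_three_mul hn hp.1.1.2 (by omega),
          pow_zero]
      rw [h1, mul_one]
      refine (Finset.prod_le_prod' fun p hp => (?_ : f p ≤ p)).trans ?_
      · simp only [R, Finset.mem_filter] at hp
        refine (pow_right_mono₀ hp.1.1.1.2.one_lt.le ?_).trans (pow_one p).le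
        exact Nat.factorization_choose_le_one (Nat.sqrt_lt'.mp <| not_le.1 hp.1.2)
      · refine Finset.prod_le_prod_of_subset_of_one_le' (fun p hp => ?_) ?_
        · simp only [R, Finset.mem_filter, Finset.mem_range] at hp ⊢
          exact ⟨by omega, hp.1.1.1.2⟩
        · exact fun p hp _ => (Finset.mem_filter.1 hp).2.one_lt.le
  · refine (Finset.prod_le_prod' fun p _ => hf p).trans ?_
    rw [Finset.prod_const]
    refine pow_right_mono₀ n2_pos (Finset.card_le_card fun p hp => ?_)
    simp only [R, Finset.mem_filter, Finset.mem_range, Finset.mem_Ioc] at hp ⊢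
    exact ⟨by omega, hp.1.2⟩

/-- Compare with 4^n ≤ n * centralBinom n: the primorial uses up only two thirds of n log 4, and the
remaining third must come from the other two factors. -/
theorem log_mul_card_primes_Ioc_ge {n : ℕ} (hn : 4 ≤ n) :
    n * Real.log 4 / 3 ≤ (√(2 * n) + 1 + ((Finset.Ioc n (2 * n)).filter Nat.Prime).card) *
      Real.log (2 * n) := by
  have h1 := centralBinom_le_pow_mul_pow_card_primes (n := n) (by omega)
  have h2 := (Nat.four_pow_lt_mul_centralBinom n hn).le
  set H := ((Finset.Ioc n (2 * n)).filter Nat.Prime).card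
  have h3 : 4 ^ n ≤ (2 * n) ^ (1 + Nat.sqrt (2 * n) + H) * 4 ^ (2 * n / 3) := by
    calc 4 ^ n ≤ n * n.centralBinom := h2
      _ ≤ (2 * n) * ((2 * n) ^ Nat.sqrt (2 * n) * 4 ^ (2 * n / 3) * (2 * n) ^ H) := by
        gcongr; omega
      _ = _ := by ring
  have h4 : (4 : ℝ) ^ n ≤ (2 * n) ^ (1 + Nat.sqrt (2 * n) + H) * 4 ^ (2 * n / 3) := by
    exact_mod_cast h3
  have hn0 : (0 : ℝ) < 2 * n := by positivity
  have h5 := Real.log_le_log (by positivity) h4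
  rw [Real.log_mul (by positivity) (by positivity), Real.log_pow, Real.log_pow, Real.log_pow] at h5
  have h6 : ((2 * n / 3 : ℕ) : ℝ) ≤ 2 * n / 3 := by
    refine Nat.cast_div_le.trans (by push_cast; rfl)
  have h7 : (Nat.sqrt (2 * n) : ℝ) ≤ √(2 * n) := by
    have := Real.nat_sqrt_le_real_sqrt (a := 2 * n)
    push_cast at this
    exact this
  have h8 : 0 < Real.log 4 := Real.log_pos (by norm_num)
  have h9 : 0 < Real.log (2 * n) := Real.log_pos (by
    have : (4 : ℝ) ≤ n := by exact_mod_cast hn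
    linarith)
  push_cast at h5
  have h10 : ((2 * n / 3 : ℕ) : ℝ) * Real.log 4 ≤ 2 * n / 3 * Real.log 4 := by gcongr
  have h11 : (1 + (Nat.sqrt (2 * n) : ℝ) + H) * Real.log (2 * n) ≤
      (√(2 * n) + 1 + H) * Real.log (2 * n) := by
    gcongr ?_ * _
    linarith
  linarith

theorem eventually_mul_div_log_le_card_upperHalfPrimes :
    ∀ᶠ x : ℝ in atTop, x / Real.log x / 24 ≤ ((upperHalfPrimes x).card : ℝ) := by
  have h1 : ∀ᶠ x : ℝ in atTop, (√x + 1) * Real.log x ≤ x / 24 := by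
    have h2 := (isLittleO_log_rpow_atTop (r := 1 / 2) (by norm_num)).bound
      (show (0 : ℝ) < 1 / 48 by norm_num)
    filter_upwards [h2, eventually_ge_atTop 1] with x hx hx1
    have hl : 0 ≤ Real.log x := Real.log_nonneg hx1
    rw [← Real.sqrt_eq_rpow, Real.norm_of_nonneg hl, Real.norm_of_nonneg (Real.sqrt_nonneg x)] at hx
    have h3 : 1 ≤ √x := Real.one_le_sqrt.2 hx1
    have h4 : √x * √x = x := Real.mul_self_sqrt (by linarith)
    nlinarith
  filter_upwards [h1, eventually_ge_atTop 16] with x hx hx16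
  set n := ⌊x / 2⌋₊ with hn
  have hn1 : (n : ℝ) ≤ x / 2 := Nat.floor_le (by linarith)
  have hn2 : x / 2 < n + 1 := Nat.lt_floor_add_one _
  have hn4 : 4 ≤ n := Nat.le_floor (by push_cast; linarith)
  have h2 := log_mul_card_primes_Ioc_ge hn4
  have hsub : (Finset.Ioc n (2 * n)).filter Nat.Prime ⊆ upperHalfPrimes x := by
    refine Finset.filter_subset_filter _ (Finset.Ioc_subset_Ioc_right ?_)
    refine Nat.le_floor ?_
    push_cast
    linarith
  have h3 : (((Finset.Ioc n (2 * n)).filter Nat.Prime).card : ℝ) ≤ (upperHalfPrimes x).card := by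
    exact_mod_cast Finset.card_le_card hsub
  have hlx : 0 < Real.log x := Real.log_pos (by linarith)
  have h4 : n * Real.log 4 / 3 ≤ (√x + 1 + (upperHalfPrimes x).card) * Real.log x := by
    refine h2.trans ?_
    have hn4' : (4 : ℝ) ≤ n := by exact_mod_cast hn4
    have := Real.log_nonneg (show (1 : ℝ) ≤ 2 * n by linarith)
    gcongr <;> linarith
  have h5 : 1 ≤ Real.log 4 := by
    rw [Real.le_log_iff_exp_le (by norm_num)]
    exact Real.exp_one_lt_d9.le.trans (by norm_num)
  have h6 : x / 4 ≤ n := by linarith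
  have h7 : x / 4 / 3 ≤ n * Real.log 4 / 3 := by nlinarith
  rw [div_div, div_le_iff₀ (by positivity)]
  nlinarith

theorem primeCounting_floor_le {x : ℝ} (hx : 1 < x) :
    (Nat.primeCounting ⌊x⌋₊ : ℝ) ≤ 100 * (x / Real.log x) := by
  have h := card_primes_modEq_le 0 one_pos (x := x) (by simpa using hx)
  simp only [Nat.cast_one, div_one, Nat.totient_one, one_mul, Nat.modEq_one, and_true] at h
  have h1 : Nat.primeCounting ⌊x⌋₊ = ((Finset.Icc 1 ⌊x⌋₊).filter Nat.Prime).card := by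
    rw [Nat.primeCounting, Nat.primeCounting', Nat.count_eq_card_filter_range]
    congr 1
    ext p
    simp only [Finset.mem_filter, Finset.mem_range, Finset.mem_Icc]
    constructor
    · rintro ⟨h1, h2⟩
      exact ⟨⟨h2.one_lt.le, by omega⟩, h2⟩
    · rintro ⟨h1, h2⟩
      exact ⟨by omega, h2⟩
  rw [h1]
  exact h

/-! ### Exponential moments of the number of prime divisors in `S`, over residues -/

theorem sum_range_mul_of_coprime {R : Type*} [AddCommMonoid R] {m n : ℕ} (hm : 0 < m) (hn : 0 < n)
    (h : Nat.Coprime m n) (F : ℕ → ℕ → R) :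
    ∑ a ∈ Finset.range (m * n), F (a % m) (a % n) =
      ∑ i ∈ Finset.range m, ∑ j ∈ Finset.range n, F i j := by
  rw [← Finset.sum_product']
  refine Finset.sum_nbij' (fun a => (a % m, a % n))
    (fun t => (Nat.chineseRemainder h t.1 t.2 : ℕ)) ?_ ?_ ?_ ?_ ?_
  · intro a _
    simp [Nat.mod_lt _ hm, Nat.mod_lt _ hn]
  · intro t _
    exact Finset.mem_range.2 (Nat.chineseRemainder_lt_mul h t.1 t.2 hm.ne' hn.ne')
  · intro a ha
    have h1 := (Nat.chineseRemainder h (a % m) (a % n)).2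
    have h2 : (Nat.chineseRemainder h (a % m) (a % n) : ℕ) ≡ a [MOD m * n] :=
      (Nat.modEq_and_modEq_iff_modEq_mul h).1
        ⟨h1.1.trans (Nat.mod_modEq a m), h1.2.trans (Nat.mod_modEq a n)⟩
    exact Nat.ModEq.eq_of_lt_of_lt h2
      (Nat.chineseRemainder_lt_mul h _ _ hm.ne' hn.ne') (Finset.mem_range.1 ha)
  · intro t ht
    simp only [Finset.mem_product, Finset.mem_range] at ht
    have h1 := (Nat.chineseRemainder h t.1 t.2).2
    refine Prod.ext ?_ ?_
    · exact Eq.trans h1.1 (Nat.mod_eq_of_lt ht.1)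
    · exact Eq.trans h1.2 (Nat.mod_eq_of_lt ht.2)
  · intro a _
    rfl

section PrimeProduct

variable {S : Finset ℕ}

theorem prod_primes_pos (hS : ∀ p ∈ S, p.Prime) : 0 < ∏ p ∈ S, p :=
  Finset.prod_pos fun p hp => (hS p hp).pos

theorem coprime_prod_primes {p : ℕ} (hp : p.Prime) (hS : ∀ p ∈ S, p.Prime) (h : p ∉ S) :
    Nat.Coprime p (∏ p ∈ S, p) :=
  Nat.Coprime.prod_right fun q hq => (Nat.coprime_primes hp (hS q hq)).2 fun h1 => h (h1 ▸ hq)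

theorem coprime_prod_iff (hS : ∀ p ∈ S, p.Prime) (n : ℕ) :
    Nat.Coprime n (∏ p ∈ S, p) ↔ ∀ p ∈ S, ¬ p ∣ n := by
  rw [Nat.coprime_prod_right_iff]
  exact forall₂_congr fun p hp => by rw [Nat.coprime_comm, (hS p hp).coprime_iff_not_dvd]

theorem totient_prod_primes (hS : ∀ p ∈ S, p.Prime) :
    (Nat.totient (∏ p ∈ S, p) : ℝ) = ∏ p ∈ S, ((p : ℝ) - 1) := by
  induction S using Finset.induction_on with
  | empty => simp
  | insert p S hpS ih =>
    have hp := hS p (Finset.mem_insert_self _ _)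
    have hS' : ∀ p ∈ S, p.Prime := fun q hq => hS q (Finset.mem_insert_of_mem hq)
    rw [Finset.prod_insert hpS, Finset.prod_insert hpS,
      Nat.totient_mul (coprime_prod_primes hp hS' hpS), Nat.totient_prime hp, Nat.cast_mul, ih hS',
      Nat.cast_sub hp.one_le, Nat.cast_one]

theorem sum_range_prod_primes {R : Type*} [CommSemiring R] (hS : ∀ p ∈ S, p.Prime)
    (g : ℕ → ℕ → R) :
    ∑ a ∈ Finset.range (∏ p ∈ S, p), ∏ p ∈ S, g p (a % p) =
      ∏ p ∈ S, ∑ a ∈ Finset.range p, g p a := by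
  induction S using Finset.induction_on with
  | empty => simp
  | insert p S hpS ih =>
    have hp := hS p (Finset.mem_insert_self _ _)
    have hS' : ∀ p ∈ S, p.Prime := fun q hq => hS q (Finset.mem_insert_of_mem hq)
    rw [Finset.prod_insert hpS, Finset.prod_insert hpS, ← ih hS', Finset.sum_mul_sum,
      ← sum_range_mul_of_coprime hp.pos (prod_primes_pos hS') (coprime_prod_primes hp hS' hpS)
        fun i j => g p i * ∏ q ∈ S, g q (j % q)]
    refine Finset.sum_congr rfl fun a _ => ?_
    rw [Finset.prod_insert hpS]
    congr 1
    refine Finset.prod_congr rfl fun q hq => ?_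
    rw [Nat.mod_mod_of_dvd _ (Finset.dvd_prod_of_mem _ hq)]

theorem sum_sum_range_prod_primes {R : Type*} [CommSemiring R] (hS : ∀ p ∈ S, p.Prime)
    (g : ℕ → ℕ → ℕ → R) :
    ∑ a ∈ Finset.range (∏ p ∈ S, p), ∑ b ∈ Finset.range (∏ p ∈ S, p),
      ∏ p ∈ S, g p (a % p) (b % p) =
      ∏ p ∈ S, ∑ a ∈ Finset.range p, ∑ b ∈ Finset.range p, g p a b := by
  simp_rw [fun a => sum_range_prod_primes hS fun p b => g p (a % p) b]
  exact sum_range_prod_primes hS fun p a => ∑ b ∈ Finset.range p, g p a b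

/-- The number of primes in `S` dividing `n`. -/
def countDvd (S : Finset ℕ) (n : ℕ) : ℕ := (S.filter (· ∣ n)).card

/-- Writes the moment weight t ^ `countDvd`, restricted to n + 1 coprime to the modulus, as a
product of local factors, so that its sum over residues splits by the Chinese remainder theorem. -/
theorem prod_ite_eq_ite_pow (hS : ∀ p ∈ S, p.Prime) (t : ℝ) (n : ℕ) :
    ∏ p ∈ S, (if p ∣ n + 1 then 0 else if p ∣ n then t else 1) =
      if Nat.Coprime (n + 1) (∏ p ∈ S, p) then t ^ countDvd S n else 0 := by
  split_ifs with h
  · rw [coprime_prod_iff hS] at h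
    rw [Finset.prod_congr rfl fun p hp => if_neg (h p hp), ← Finset.prod_filter, countDvd,
      Finset.prod_const]
  · rw [coprime_prod_iff hS] at h
    push Not at h
    obtain ⟨p, hp, hpn⟩ := h
    exact Finset.prod_eq_zero hp (if_pos hpn)

/-- As a is invertible mod p, one b has a * b ≡ -1 (weight 0), b = 0 has weight t, and the other p -
2 have weight 1. -/
theorem sum_range_weight_of_coprime {p a : ℕ} (hp : p.Prime) (ha : ¬ p ∣ a) (t : ℝ) :
    ∑ b ∈ Finset.range p, (if p ∣ a * b + 1 then 0 else if p ∣ a * b then t else 1) =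
      t + (p - 2) := by
  obtain ⟨v, hv⟩ := exists_modEq_iff_dvd ((Nat.Prime.coprime_iff_not_dvd hp).2 ha) hp.pos 1
  have h1 : ∀ b ∈ Finset.range p, (if p ∣ a * b + 1 then 0 else if p ∣ a * b then t else 1) =
      1 + (if b = 0 then t - 1 else 0) - (if b = v % p then (1 : ℝ) else 0) := by
    intro b hb
    rw [Finset.mem_range] at hb
    have h2 : p ∣ a * b + 1 ↔ b = v % p := by
      rw [add_comm, hv b, Nat.ModEq, Nat.mod_eq_of_lt hb]
    have h3 : p ∣ a * b ↔ b = 0 := by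
      rw [hp.dvd_mul, or_iff_right ha]
      exact ⟨fun h => Nat.eq_zero_of_dvd_of_lt h hb, fun h => h ▸ dvd_zero p⟩
    by_cases h4 : b = 0
    · have h5 : ¬ p ∣ a * b + 1 := by
        rw [h4, mul_zero, zero_add]; exact hp.one_lt.ne' ∘ Nat.dvd_one.1
      rw [if_neg h5, if_pos (h3.2 h4), if_pos h4, if_neg (fun h => h5 (h2.2 h))]
      ring
    · rw [if_neg h4]
      simp only [h2, h3, h4, if_false]
      split_ifs <;> ring
  rw [Finset.sum_congr rfl h1, Finset.sum_sub_distrib, Finset.sum_add_distrib,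
    Finset.sum_ite_eq', Finset.sum_ite_eq', if_pos (Finset.mem_range.2 hp.pos),
    if_pos (Finset.mem_range.2 (Nat.mod_lt _ hp.pos))]
  simp
  ring

theorem sum_sum_range_weight {p : ℕ} (hp : p.Prime) (t : ℝ) :
    ∑ a ∈ Finset.range p, ∑ b ∈ Finset.range p,
      (if p ∣ a * b + 1 then 0 else if p ∣ a * b then t else 1) =
      p * t + (p - 1) * (t + (p - 2)) := by
  rw [← Finset.add_sum_erase _ _ (Finset.mem_range.2 hp.pos)]
  have h2 : ∀ a ∈ (Finset.range p).erase 0, ∑ b ∈ Finset.range p,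
      (if p ∣ a * b + 1 then 0 else if p ∣ a * b then t else 1) = t + (p - 2) := by
    intro a ha
    rw [Finset.mem_erase, Finset.mem_range] at ha
    exact sum_range_weight_of_coprime hp (fun h => ha.1 (Nat.eq_zero_of_dvd_of_lt h ha.2)) t
  rw [Finset.sum_congr rfl h2, Finset.sum_const, Finset.card_erase_of_mem (Finset.mem_range.2 hp.pos)]
  have h3 : p ≠ 1 := hp.one_lt.ne'
  simp [h3, Nat.cast_sub hp.one_le]
  ring

theorem sum_weight_one (hS : ∀ p ∈ S, p.Prime) (t : ℝ) :
    ∑ a ∈ Finset.range (∏ p ∈ S, p),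
      (if Nat.Coprime (a + 1) (∏ p ∈ S, p) then t ^ countDvd S a else 0) =
      ∏ p ∈ S, (t + ((p : ℝ) - 2)) := by
  simp_rw [← prod_ite_eq_ite_pow hS]
  have h := sum_range_prod_primes hS fun p a => if p ∣ a + 1 then 0 else if p ∣ a then t else 1
  refine Eq.trans ?_ (h.trans ?_)
  · refine Finset.sum_congr rfl fun a _ => Finset.prod_congr rfl fun p _ => ?_
    have h1 : p ∣ a ↔ p ∣ a % p := by
      rw [Nat.dvd_iff_mod_eq_zero, Nat.dvd_iff_mod_eq_zero, Nat.mod_mod]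
    have h2 : p ∣ a + 1 ↔ p ∣ a % p + 1 := by
      rw [Nat.dvd_iff_mod_eq_zero, Nat.dvd_iff_mod_eq_zero, Nat.mod_add_mod]
    simp only [← h1, ← h2]
  · refine Finset.prod_congr rfl fun p hp => ?_
    rw [← sum_range_weight_of_coprime (hS p hp) (a := 1) ((hS p hp).one_lt.ne' ∘ Nat.dvd_one.1) t]
    simp

theorem sum_weight_two (hS : ∀ p ∈ S, p.Prime) (t : ℝ) :
    ∑ a ∈ Finset.range (∏ p ∈ S, p), ∑ b ∈ Finset.range (∏ p ∈ S, p),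
      (if Nat.Coprime (a * b + 1) (∏ p ∈ S, p) then t ^ countDvd S (a * b) else 0) =
      ∏ p ∈ S, (p * t + (p - 1) * (t + ((p : ℝ) - 2))) := by
  simp_rw [← prod_ite_eq_ite_pow hS]
  have h := sum_sum_range_prod_primes hS fun p a b =>
    if p ∣ a * b + 1 then 0 else if p ∣ a * b then t else 1
  refine Eq.trans ?_ (h.trans ?_)
  · refine Finset.sum_congr rfl fun a _ => Finset.sum_congr rfl fun b _ =>
      Finset.prod_congr rfl fun p _ => ?_
    have h1 : p ∣ a * b ↔ p ∣ a % p * (b % p) := by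
      rw [Nat.dvd_iff_mod_eq_zero, Nat.dvd_iff_mod_eq_zero, ← Nat.mul_mod]
    have h2 : p ∣ a * b + 1 ↔ p ∣ a % p * (b % p) + 1 := by
      rw [Nat.dvd_iff_mod_eq_zero, Nat.dvd_iff_mod_eq_zero, Nat.add_mod, Nat.mul_mod,
        Nat.add_mod (a % p * (b % p))]
    simp only [h1, h2]
  · exact Finset.prod_congr rfl fun p hp => sum_sum_range_weight (hS p hp) t

theorem sum_one_div_mul_sub_one_le (hS : ∀ p ∈ S, p.Prime) :
    ∑ p ∈ S, (1 : ℝ) / (p * (p - 1)) ≤ 1 := by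
  have h1 : ∀ N : ℕ, ∑ n ∈ Finset.Icc 2 (N + 1), (1 : ℝ) / (n * (n - 1)) ≤ 1 - 1 / (N + 1) := by
    intro N
    induction N with
    | zero => simp
    | succ N ih =>
      rw [Finset.sum_Icc_succ_top (by omega)]
      have : (1 : ℝ) / (((N + 1 + 1 : ℕ) : ℝ) * (((N + 1 + 1 : ℕ) : ℝ) - 1)) =
          1 / (N + 1) - 1 / ((N + 1 : ℕ) + 1) := by
        push_cast
        field_simp
        ring
      rw [this]
      linarith
  have h2 : S ⊆ Finset.Icc 2 (S.sup id + 1) := fun p hp =>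
    Finset.mem_Icc.2 ⟨(hS p hp).two_le, (Finset.le_sup (f := id) hp).trans (Nat.le_succ _)⟩
  refine (Finset.sum_le_sum_of_subset_of_nonneg h2 fun n hn _ => ?_).trans ((h1 _).trans ?_)
  · have : (2 : ℝ) ≤ n := by exact_mod_cast (Finset.mem_Icc.1 hn).1
    have : (0 : ℝ) ≤ n - 1 := by linarith
    positivity
  · have : (0 : ℝ) ≤ 1 / ((S.sup id : ℕ) + 1) := by positivity
    linarith

/-- Few reduced residues `c + 1` modulo `∏ p ∈ S, p` have `c` divisible by many primes of `S`. -/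
theorem card_residues_many_le (hS : ∀ p ∈ S, p.Prime) :
    (((Finset.range (∏ p ∈ S, p)).filter (fun c => Nat.Coprime (c + 1) (∏ p ∈ S, p) ∧
      3 / 2 * ∑ p ∈ S, (1 : ℝ) / p < countDvd S c)).card : ℝ) ≤
      Nat.totient (∏ p ∈ S, p) * Real.exp (1 - 1 / 20 * ∑ p ∈ S, (1 : ℝ) / p) := by
  set L := ∑ p ∈ S, (1 : ℝ) / p with hL
  have hL0 : 0 ≤ L := Finset.sum_nonneg fun _ _ => by positivity
  -- Rankin's trick with base 3/2: passing the threshold 3L/2 gains exp(-3L/5), while the mean of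
  -- the weight over reduced residues is about exp(L/2).
  have h32 : Real.exp (2 / 5) ≤ 3 / 2 := by
    have h1 : Real.exp (2 / 5) ^ 5 ≤ (3 / 2) ^ 5 := by
      rw [← Real.exp_nat_mul]
      have : ((5 : ℕ) : ℝ) * (2 / 5) = 1 + 1 := by norm_num
      rw [this, Real.exp_add]
      have := Real.exp_one_lt_d9
      nlinarith [Real.exp_pos 1]
    exact (pow_le_pow_iff_left₀ (Real.exp_pos _).le (by norm_num) (by norm_num)).1 h1
  calc _ = ∑ c ∈ Finset.range (∏ p ∈ S, p), if (Nat.Coprime (c + 1) (∏ p ∈ S, p) ∧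
      3 / 2 * L < countDvd S c) then (1 : ℝ) else 0 := by simp
    _ ≤ ∑ c ∈ Finset.range (∏ p ∈ S, p), Real.exp (-(3 / 5 * L)) *
        (if Nat.Coprime (c + 1) (∏ p ∈ S, p) then (3 / 2 : ℝ) ^ countDvd S c else 0) := by
        refine Finset.sum_le_sum fun c _ => ?_
        by_cases h1 : Nat.Coprime (c + 1) (∏ p ∈ S, p)
        · by_cases h2 : 3 / 2 * L < countDvd S c
          · rw [if_pos ⟨h1, h2⟩, if_pos h1]
            have h3 : Real.exp (3 / 5 * L) ≤ (3 / 2 : ℝ) ^ countDvd S c := by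
              calc _ ≤ Real.exp (countDvd S c * (2 / 5)) := Real.exp_le_exp.2 (by linarith)
                _ = Real.exp (2 / 5) ^ countDvd S c := Real.exp_nat_mul _ _
                _ ≤ _ := by gcongr
            calc (1 : ℝ) = Real.exp (-(3 / 5 * L)) * Real.exp (3 / 5 * L) := by
                  rw [← Real.exp_add]; simp
              _ ≤ _ := by gcongr
          · rw [if_neg fun h => h2 h.2, if_pos h1]
            positivity
        · rw [if_neg fun h => h1 h.1, if_neg h1, mul_zero]
    _ = Real.exp (-(3 / 5 * L)) * ∏ p ∈ S, (3 / 2 + ((p : ℝ) - 2)) := by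
        rw [← Finset.mul_sum, sum_weight_one hS]
    _ ≤ Real.exp (-(3 / 5 * L)) * ∏ p ∈ S, (((p : ℝ) - 1) *
        Real.exp (1 / 2 * (1 / p + 1 / (p * (p - 1))))) := by
        gcongr with p hp
        · intro p hp
          have : (2 : ℝ) ≤ p := by exact_mod_cast (hS p hp).two_le
          linarith
        · have h2 : (2 : ℝ) ≤ p := by exact_mod_cast (hS p hp).two_le
          have h3 : (0 : ℝ) < p - 1 := by linarith
          have h4 := Real.add_one_le_exp (1 / 2 * (1 / p + 1 / (p * ((p : ℝ) - 1))))
          calc (3 / 2 + ((p : ℝ) - 2)) =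
                (p - 1) * (1 / 2 * (1 / p + 1 / (p * ((p : ℝ) - 1))) + 1) := by
                field_simp
                ring
            _ ≤ _ := by gcongr
    _ = Nat.totient (∏ p ∈ S, p) * Real.exp (-(3 / 5 * L) + 1 / 2 * (L +
          ∑ p ∈ S, (1 : ℝ) / (p * (p - 1)))) := by
        rw [Finset.prod_mul_distrib, ← totient_prod_primes hS, ← Real.exp_sum, ← Finset.mul_sum,
          Finset.sum_add_distrib, Real.exp_add]
        ring
    _ ≤ _ := by
        gcongr
        have := sum_one_div_mul_sub_one_le hS
        linarith

/-- Few pairs of residues `(a, b)` modulo `∏ p ∈ S, p` have `a * b` divisible by few primes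
of `S`. -/
theorem card_residue_pairs_few_le (hS : ∀ p ∈ S, p.Prime) :
    (((Finset.range (∏ p ∈ S, p) ×ˢ Finset.range (∏ p ∈ S, p)).filter
      (fun t => Nat.Coprime (t.1 * t.2 + 1) (∏ p ∈ S, p) ∧
      (countDvd S (t.1 * t.2) : ℝ) ≤ 3 / 2 * ∑ p ∈ S, (1 : ℝ) / p)).card : ℝ) ≤
      (∏ p ∈ S, p : ℕ) * Nat.totient (∏ p ∈ S, p) *
        Real.exp (1 - 1 / 20 * ∑ p ∈ S, (1 : ℝ) / p) := by
  set L := ∑ p ∈ S, (1 : ℝ) / p with hL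
  have hL0 : 0 ≤ L := Finset.sum_nonneg fun _ _ => by positivity
  -- Rankin's trick with base 3/4: staying below the threshold costs exp(9L/20), while the mean of
  -- the weight is about exp(-L/2), since a prime p divides a * b with probability about 2/p.
  have h34 : Real.exp (-(3 / 10)) ≤ 3 / 4 := by
    have h1 : Real.exp (-(3 / 10)) ^ 10 ≤ (3 / 4) ^ 10 := by
      rw [← Real.exp_nat_mul]
      have : ((10 : ℕ) : ℝ) * -(3 / 10) = -(1 + 1 + 1) := by norm_num
      rw [this, Real.exp_neg, Real.exp_add, Real.exp_add]
      have h1 := Real.exp_one_gt_d9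
      rw [inv_le_comm₀ (by positivity) (by norm_num)]
      calc ((3 / 4 : ℝ) ^ 10)⁻¹ ≤ 2.7 * 2.7 * 2.7 := by norm_num
        _ ≤ _ := by gcongr <;> linarith
    exact (pow_le_pow_iff_left₀ (Real.exp_pos _).le (by norm_num) (by norm_num)).1 h1
  calc _ = ∑ a ∈ Finset.range (∏ p ∈ S, p), ∑ b ∈ Finset.range (∏ p ∈ S, p),
      if (Nat.Coprime (a * b + 1) (∏ p ∈ S, p) ∧ (countDvd S (a * b) : ℝ) ≤ 3 / 2 * L)
        then (1 : ℝ) else 0 := by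
        rw [Finset.card_filter, Nat.cast_sum, Finset.sum_product]
        simp
    _ ≤ ∑ a ∈ Finset.range (∏ p ∈ S, p), ∑ b ∈ Finset.range (∏ p ∈ S, p),
        Real.exp (9 / 20 * L) * (if Nat.Coprime (a * b + 1) (∏ p ∈ S, p) then
          (3 / 4 : ℝ) ^ countDvd S (a * b) else 0) := by
        refine Finset.sum_le_sum fun a _ => Finset.sum_le_sum fun b _ => ?_
        by_cases h1 : Nat.Coprime (a * b + 1) (∏ p ∈ S, p)
        · by_cases h2 : (countDvd S (a * b) : ℝ) ≤ 3 / 2 * L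
          · rw [if_pos ⟨h1, h2⟩, if_pos h1]
            have h3 : Real.exp (-(9 / 20 * L)) ≤ (3 / 4 : ℝ) ^ countDvd S (a * b) := by
              calc _ ≤ Real.exp (countDvd S (a * b) * -(3 / 10)) :=
                    Real.exp_le_exp.2 (by linarith)
                _ = Real.exp (-(3 / 10)) ^ countDvd S (a * b) := Real.exp_nat_mul _ _
                _ ≤ _ := by gcongr
            calc (1 : ℝ) = Real.exp (9 / 20 * L) * Real.exp (-(9 / 20 * L)) := by
                  rw [← Real.exp_add]; simp
              _ ≤ _ := by gcongr
          · rw [if_neg fun h => h2 h.2, if_pos h1]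
            positivity
        · rw [if_neg fun h => h1 h.1, if_neg h1, mul_zero]
    _ = Real.exp (9 / 20 * L) *
        ∏ p ∈ S, (p * (3 / 4 : ℝ) + (p - 1) * (3 / 4 + ((p : ℝ) - 2))) := by
        simp_rw [← Finset.mul_sum]
        rw [sum_weight_two hS]
    _ ≤ Real.exp (9 / 20 * L) * ∏ p ∈ S, (p * ((p : ℝ) - 1) *
        Real.exp (-(1 / 2) * (1 / p) + 3 / 4 * (1 / (p * (p - 1))))) := by
        gcongr with p hp
        · intro p hp
          have : (2 : ℝ) ≤ p := by exact_mod_cast (hS p hp).two_le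
          nlinarith
        · have h2 : (2 : ℝ) ≤ p := by exact_mod_cast (hS p hp).two_le
          have h3 : (0 : ℝ) < p - 1 := by linarith
          have h4 := Real.add_one_le_exp
            (-(1 / 2) * (1 / p) + 3 / 4 * (1 / (p * ((p : ℝ) - 1))))
          calc (p * (3 / 4 : ℝ) + (p - 1) * (3 / 4 + ((p : ℝ) - 2))) = p * ((p : ℝ) - 1) *
                (-(1 / 2) * (1 / p) + 3 / 4 * (1 / (p * ((p : ℝ) - 1))) + 1) := by
                field_simp
                ring
            _ ≤ _ := by gcongr
    _ = (∏ p ∈ S, p : ℕ) * Nat.totient (∏ p ∈ S, p) * Real.exp (9 / 20 * L +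
          (-(1 / 2) * L + 3 / 4 * ∑ p ∈ S, (1 : ℝ) / (p * (p - 1)))) := by
        rw [Finset.prod_mul_distrib, Finset.prod_mul_distrib, ← totient_prod_primes hS,
          ← Real.exp_sum, Finset.sum_add_distrib, ← Finset.mul_sum, ← Finset.mul_sum, ← hL,
          Real.exp_add (9 / 20 * L)]
        push_cast
        ring
    _ ≤ _ := by
        gcongr
        have := sum_one_div_mul_sub_one_le hS
        linarith

end PrimeProduct

/-! ### Averaging 1/φ(d * M) over d in a progression -/

theorem exists_finset_primes_sum_one_div_ge (B : ℝ) :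
    ∃ S : Finset ℕ, (∀ p ∈ S, p.Prime) ∧ B ≤ ∑ p ∈ S, (1 : ℝ) / p := by
  have h := Nat.Primes.not_summable_one_div
  by_contra! h1
  refine h (summable_of_sum_le (c := B) (fun _ => by positivity) fun u => ?_)
  have h2 := h1 (u.map ⟨fun p : Nat.Primes => (p : ℕ), Subtype.val_injective⟩) (by
    intro p hp
    obtain ⟨q, -, rfl⟩ := Finset.mem_map.1 hp
    exact q.2)
  rw [Finset.sum_map] at h2
  exact h2.le

theorem card_modEq_and_dvd_le (Y a : ℕ) {M e : ℕ} (hM : 0 < M) (he : 0 < e) (h : Nat.Coprime M e) :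
    (((Finset.range (Y + 1)).filter (fun d => d ≡ a [MOD M] ∧ e ∣ d)).card : ℝ) ≤
      Y / (M * e) + 2 := by
  have h1 : ∀ d, (d ≡ a [MOD M] ∧ e ∣ d) ↔ d ≡ (Nat.chineseRemainder h a 0 : ℕ) [MOD M * e] := by
    intro d
    have h2 := (Nat.chineseRemainder h a 0).2
    rw [← Nat.modEq_and_modEq_iff_modEq_mul h, ← Nat.modEq_zero_iff_dvd]
    exact ⟨fun h3 => ⟨h3.1.trans h2.1.symm, h3.2.trans h2.2.symm⟩,
      fun h3 => ⟨h3.1.trans h2.1, h3.2.trans h2.2⟩⟩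
  simp_rw [h1]
  have h3 := (abs_le.1 (abs_card_modEq_sub_le (Y + 1) (Nat.chineseRemainder h a 0 : ℕ)
    (Nat.mul_pos hM he))).2
  push_cast at h3
  have h4 : (1 : ℝ) / (M * e) ≤ 1 := by
    rw [div_le_one (by positivity)]
    exact_mod_cast Nat.mul_pos hM he
  rw [add_div] at h3
  linarith

/-- Each factor on the left is at most exp(1/(p(p - 1))) times that on the right, and these
exponents sum to at most 1; finally e < 3. -/
theorem prod_inv_one_sub_inv_le {T : Finset ℕ} (hT : ∀ p ∈ T, p.Prime) :
    ∏ p ∈ T, (1 - (p : ℝ)⁻¹)⁻¹ ≤ 3 * ∏ p ∈ T, (1 + (p : ℝ)⁻¹) := by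
  calc ∏ p ∈ T, (1 - (p : ℝ)⁻¹)⁻¹
      ≤ ∏ p ∈ T, (Real.exp (1 / (p * (p - 1))) * (1 + (p : ℝ)⁻¹)) := by
        refine Finset.prod_le_prod (fun p hp => ?_) fun p hp => ?_
        · exact (inv_pos.2 (one_add_inv_le_inv_one_sub_inv (hT p hp)).1).le
        · have h2 : (2 : ℝ) ≤ p := by exact_mod_cast (hT p hp).two_le
          have h3 : (0 : ℝ) < p - 1 := by linarith
          have h4 := Real.add_one_le_exp (1 / (p * ((p : ℝ) - 1)))
          calc (1 - (p : ℝ)⁻¹)⁻¹ ≤ (1 / (p * ((p : ℝ) - 1)) + 1) * (1 + (p : ℝ)⁻¹) := by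
                have h5 : (1 - (p : ℝ)⁻¹)⁻¹ = p / (p - 1) := by field_simp
                have h6 : (1 / (p * ((p : ℝ) - 1)) + 1) * (1 + (p : ℝ)⁻¹) - p / (p - 1) =
                    1 / ((p : ℝ) ^ 2 * (p - 1)) := by
                  field_simp
                  ring
                have h7 : 0 ≤ 1 / ((p : ℝ) ^ 2 * (p - 1)) := by positivity
                linarith
            _ ≤ _ := by gcongr
    _ = Real.exp (∑ p ∈ T, 1 / ((p : ℝ) * (p - 1))) * ∏ p ∈ T, (1 + (p : ℝ)⁻¹) := by
        rw [Finset.prod_mul_distrib, Real.exp_sum]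
    _ ≤ _ := by
        gcongr
        calc _ ≤ Real.exp 1 := Real.exp_le_exp.2 (sum_one_div_mul_sub_one_le hT)
          _ ≤ 3 := Real.exp_one_lt_d9.le.trans (by norm_num)

/-- Only the primes of d not dividing M enlarge 1/φ(d * M) beyond 1/(d φ(M)). Their Euler product
expands into reciprocals of divisors e of d coprime to M, a form that can be averaged over d. -/
theorem one_div_totient_mul_le {d M : ℕ} (hd : 0 < d) (hM : 0 < M) :
    (1 : ℝ) / Nat.totient (d * M) ≤ 3 / (d * Nat.totient M) *
      ∑ e ∈ d.divisors.filter (fun e => Nat.Coprime M e), (1 : ℝ) / e := by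
  set T := d.primeFactors \ M.primeFactors with hT
  have hTp : ∀ p ∈ T, p.Prime := fun p hp =>
    Nat.prime_of_mem_primeFactors (Finset.mem_sdiff.1 hp).1
  have hd' : (0 : ℝ) < d := by exact_mod_cast hd
  have hφ : (0 : ℝ) < Nat.totient M := by exact_mod_cast Nat.totient_pos.2 hM
  have h1 : (Nat.totient (d * M) : ℝ) = d * Nat.totient M * ∏ p ∈ T, (1 - (p : ℝ)⁻¹) := by
    rw [cast_totient_eq, Nat.primeFactors_mul hd.ne' hM.ne', cast_totient_eq M,
      ← Finset.sdiff_union_self_eq_union, Finset.prod_union Finset.sdiff_disjoint]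
    push_cast
    ring
  have hTd : ∏ p ∈ T, p ∣ d :=
    (Finset.prod_dvd_prod_of_subset _ _ _ Finset.sdiff_subset).trans (Nat.prod_primeFactors_dvd d)
  have h2 : ∏ p ∈ T, (1 + (p : ℝ)⁻¹) ≤
      ∑ e ∈ d.divisors.filter (fun e => Nat.Coprime M e), (1 : ℝ) / e := by
    have h3 := sum_squarefree_divisors_inv (prod_primes_pos hTp).ne'
    rw [Nat.primeFactors_prod hTp] at h3
    rw [← h3]
    refine Finset.sum_le_sum_of_subset_of_nonneg (fun e he => ?_) fun _ _ _ => by positivity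
    simp only [Finset.mem_filter, Nat.mem_divisors] at he ⊢
    refine ⟨⟨he.1.1.trans hTd, hd.ne'⟩, ?_⟩
    refine Nat.Coprime.coprime_dvd_right he.1.1 ((coprime_prod_iff hTp M).2 fun p hp hpM => ?_)
    exact (Finset.mem_sdiff.1 hp).2 (Nat.mem_primeFactors.2 ⟨hTp p hp, hpM, hM.ne'⟩)
  rw [h1, one_div, mul_inv, ← Finset.prod_inv_distrib]
  calc _ ≤ ((d : ℝ) * Nat.totient M)⁻¹ * (3 * ∏ p ∈ T, (1 + (p : ℝ)⁻¹)) := by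
        gcongr
        exact prod_inv_one_sub_inv_le hTp
    _ ≤ ((d : ℝ) * Nat.totient M)⁻¹ *
        (3 * ∑ e ∈ d.divisors.filter (fun e => Nat.Coprime M e), (1 : ℝ) / e) := by gcongr
    _ = _ := by ring

/-- Exchanging the sums over d and e leaves ∑ (1/e) (Y/(M e) + 2) with Y ≤ 8D. The first part
converges; `hDM` makes the harmonic part at most 2D/M. -/
theorem sum_one_div_totient_mul_le {M : ℕ} (hM : 0 < M) (a : ℕ) {D : ℝ} (hD : 1 ≤ D)
    (hDM : 1 + Real.log (8 * D) ≤ D / M) :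
    ∑ d ∈ (Finset.Ioc ⌊D⌋₊ ⌊8 * D⌋₊).filter (fun d => d ≡ a [MOD M]),
      (1 : ℝ) / Nat.totient (d * M) ≤ 54 / (M * Nat.totient M) := by
  have hM' : (0 : ℝ) < M := by exact_mod_cast hM
  have hφ : (0 : ℝ) < Nat.totient M := by exact_mod_cast Nat.totient_pos.2 hM
  set Y := ⌊8 * D⌋₊ with hY
  have hY8 : (Y : ℝ) ≤ 8 * D := Nat.floor_le (by linarith)
  have hY1 : 1 ≤ Y := Nat.le_floor (by push_cast; linarith)
  set I := (Finset.Ioc ⌊D⌋₊ Y).filter (fun d => d ≡ a [MOD M]) with hI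
  have hmem : ∀ d ∈ I, D ≤ d ∧ d ≤ Y ∧ d ≡ a [MOD M] := by
    intro d hd
    simp only [hI, Finset.mem_filter, Finset.mem_Ioc] at hd
    exact ⟨(Nat.lt_of_floor_lt hd.1.1).le, hd.1.2, hd.2⟩
  calc ∑ d ∈ I, (1 : ℝ) / Nat.totient (d * M)
      ≤ ∑ d ∈ I, 3 / (D * Nat.totient M) *
        ∑ e ∈ Finset.Icc 1 Y, if Nat.Coprime M e ∧ e ∣ d then (1 : ℝ) / e else 0 := by
        refine Finset.sum_le_sum fun d hd => ?_
        obtain ⟨h1, h2, -⟩ := hmem d hd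
        have hd0 : (0 : ℝ) < d := by linarith
        have hd0' : 0 < d := by exact_mod_cast hd0
        refine (one_div_totient_mul_le hd0' hM).trans ?_
        rw [← Finset.sum_filter]
        gcongr
        intro e he
        simp only [Finset.mem_filter, Nat.mem_divisors, Finset.mem_Icc] at he ⊢
        exact ⟨⟨Nat.pos_of_dvd_of_pos he.1.1 hd0', (Nat.le_of_dvd hd0' he.1.1).trans h2⟩,
          he.2, he.1.1⟩
    _ = 3 / (D * Nat.totient M) * ∑ e ∈ Finset.Icc 1 Y,
          ∑ d ∈ I, if Nat.Coprime M e ∧ e ∣ d then (1 : ℝ) / e else 0 := by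
        rw [← Finset.mul_sum, Finset.sum_comm]
    _ ≤ 3 / (D * Nat.totient M) * ∑ e ∈ Finset.Icc 1 Y,
          (Y / M * (1 / (e : ℝ) ^ 2) + 2 * (1 / e)) := by
        gcongr with e he
        have he0 : 0 < e := (Finset.mem_Icc.1 he).1
        have he' : (0 : ℝ) < e := by exact_mod_cast he0
        by_cases hc : Nat.Coprime M e
        · have h1 := card_modEq_and_dvd_le Y a hM he0 hc
          calc ∑ d ∈ I, (if Nat.Coprime M e ∧ e ∣ d then (1 : ℝ) / e else 0) =
                ((I.filter (fun d => e ∣ d)).card : ℝ) * (1 / e) := by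
                simp only [fun d : ℕ => and_iff_right (b := e ∣ d) hc]
                rw [← Finset.sum_filter, Finset.sum_const, nsmul_eq_mul]
            _ ≤ (Y / (M * e) + 2) * (1 / e) := by
                gcongr
                refine le_trans ?_ h1
                norm_cast
                refine Finset.card_le_card fun d hd => ?_
                simp only [Finset.mem_filter, Finset.mem_range] at hd ⊢
                obtain ⟨-, h2, h3⟩ := hmem d hd.1
                exact ⟨by omega, h3, hd.2⟩
            _ = _ := by field_simp
        · simp only [hc, false_and, if_false, Finset.sum_const_zero]
          positivity
    _ ≤ 3 / (D * Nat.totient M) * (8 * D / M * 2 + 2 * (D / M)) := by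
        rw [Finset.sum_add_distrib, ← Finset.mul_sum, ← Finset.mul_sum]
        gcongr
        · exact sum_Icc_inv_sq_le Y
        · refine (sum_Icc_one_div_le_log Y).trans (le_trans ?_ hDM)
          have := Real.log_le_log (by exact_mod_cast hY1) hY8
          linarith
    _ = _ := by
        field_simp
        ring

/-! ### Shifted primes with a divisor in a given window -/

theorem countDvd_congr {S : Finset ℕ} {m n : ℕ} (h : m ≡ n [MOD ∏ p ∈ S, p]) :
    countDvd S m = countDvd S n := by
  unfold countDvd
  congr 1
  refine Finset.filter_congr fun p hp => ?_
  exact (h.of_dvd (Finset.dvd_prod_of_mem _ hp)).dvd_iff dvd_rfl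

/-- The primes `p ≤ x` such that `p - 1` has a divisor in `(D, 8 * D]`. -/
noncomputable def primesPredDvd (x D : ℝ) : Finset ℕ :=
  (Finset.Icc 1 ⌊x⌋₊).filter (fun p => p.Prime ∧ ∃ d ∈ Finset.Ioc ⌊D⌋₊ ⌊8 * D⌋₊, d ∣ p - 1)

/-- For q ≤ x^(3/4) one has log(x/q) ≥ (log x)/4, so Brun–Titchmarsh loses only a factor 4. -/
theorem card_primes_modEq_le_of_pow_le {q : ℕ} (r : ℕ) (hq : 0 < q) {x : ℝ} (hx : 1 < x)
    (hqx : (q : ℝ) ^ 4 ≤ x ^ 3) :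
    (((Finset.Icc 1 ⌊x⌋₊).filter (fun p => p.Prime ∧ p ≡ r [MOD q])).card : ℝ) ≤
      400 * (x / Real.log x) * (1 / Nat.totient q) := by
  have hq' : (0 : ℝ) < q := by exact_mod_cast hq
  have hφ : (0 : ℝ) < Nat.totient q := by exact_mod_cast Nat.totient_pos.2 hq
  have hx0 : 0 < x := by linarith
  have hqx' : (q : ℝ) < x := by
    refine lt_of_pow_lt_pow_left₀ 4 hx0.le (hqx.trans_lt ?_)
    exact pow_lt_pow_right₀ hx (by norm_num)
  have h1 : Real.log x ≤ 4 * Real.log (x / q) := by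
    have : x ≤ (x / q) ^ 4 := by
      rw [div_pow, le_div_iff₀ (by positivity)]
      calc x * (q : ℝ) ^ 4 ≤ x * x ^ 3 := by gcongr
        _ = x ^ 4 := by ring
    have h2 := Real.log_le_log hx0 this
    rw [Real.log_pow] at h2
    exact_mod_cast h2
  have hl : 0 < Real.log x := Real.log_pos hx
  refine (card_primes_modEq_le r hq hqx').trans ?_
  calc 100 * (x / (Nat.totient q * Real.log (x / q)))
      ≤ 100 * (x / (Nat.totient q * (Real.log x / 4))) := by
        gcongr
        linarith
    _ = _ := by field_simp; norm_num

/-- The multiplication table argument. Primes whose p - 1 has many divisors in S lie in the few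
classes `G1` mod M. For the others, p - 1 = d * m with (d, m) mod M in the sparse set `G2`, and a
fixed d and class b of m confine p to d * b + 1 mod d * M. -/
theorem card_primesPredDvd_le {S : Finset ℕ} (hS : ∀ p ∈ S, p.Prime) {x D : ℝ}
    (hD : 64 * ((∏ p ∈ S, p : ℕ) : ℝ) ^ 2 ≤ D) (hDx : D ^ 2 ≤ x)
    (hDM : 1 + Real.log (8 * D) ≤ D / (∏ p ∈ S, p : ℕ)) :
    ((primesPredDvd x D).card : ℝ) ≤
      22000 * Real.exp (1 - 1 / 20 * ∑ p ∈ S, (1 : ℝ) / p) * (x / Real.log x) := by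
  classical
  have hG1 := card_residues_many_le hS
  have hG2 := card_residue_pairs_few_le hS
  set M := ∏ p ∈ S, p with hMdef
  set L := ∑ p ∈ S, (1 : ℝ) / p with hL
  have hM : 0 < M := prod_primes_pos hS
  have hM1 : (1 : ℝ) ≤ M := by exact_mod_cast hM
  have hφ : (0 : ℝ) < Nat.totient M := by exact_mod_cast Nat.totient_pos.2 hM
  have hMM : (M : ℝ) ≤ (M : ℝ) ^ 2 := by nlinarith
  have hD1 : 64 ≤ D := by nlinarith
  have hMD : (M : ℝ) ≤ D := by nlinarith
  have hx1 : 1 < x := by nlinarith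
  have hx0 : 0 < x := by linarith
  have hlog : 0 < Real.log x := Real.log_pos hx1
  set G1 := (Finset.range M).filter (fun c => Nat.Coprime (c + 1) M ∧
    3 / 2 * L < countDvd S c)
  set G2 := (Finset.range M ×ˢ Finset.range M).filter (fun t => Nat.Coprime (t.1 * t.2 + 1) M ∧
    (countDvd S (t.1 * t.2) : ℝ) ≤ 3 / 2 * L)
  let A : ℕ → ℕ → Finset ℕ := fun q r =>
    (Finset.Icc 1 ⌊x⌋₊).filter (fun p => p.Prime ∧ p ≡ r [MOD q])
  let I : ℕ → Finset ℕ := fun a =>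
    (Finset.Ioc ⌊D⌋₊ ⌊8 * D⌋₊).filter (fun d => d ≡ a [MOD M])
  -- All moduli used are at most 8 D M; as 64 M² ≤ D and D² ≤ x, this is at most x^(3/4).
  have hpow : ∀ q : ℕ, (q : ℝ) ≤ 8 * D * M → (q : ℝ) ^ 4 ≤ x ^ 3 := by
    intro q hq
    calc (q : ℝ) ^ 4 ≤ (8 * D * M) ^ 4 := by gcongr
      _ = (64 * (M : ℝ) ^ 2) ^ 2 * (D ^ 2) ^ 2 := by ring
      _ ≤ D ^ 2 * (D ^ 2) ^ 2 := by gcongr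
      _ = (D ^ 2) ^ 3 := by ring
      _ ≤ x ^ 3 := by gcongr
  have hcover : primesPredDvd x D ⊆ (G1.biUnion fun c => A M (c + 1)) ∪
      G2.biUnion fun t => (I t.1).biUnion fun d => A (d * M) (d * t.2 + 1) := by
    intro p hp
    simp only [primesPredDvd, Finset.mem_filter] at hp
    obtain ⟨hpx, hpp, d, hd, m, hm⟩ := hp
    have hd1 := Finset.mem_Ioc.1 hd
    have hp1 : p = d * m + 1 := by
      have := hpp.one_le
      omega
    have hm0 : 0 < m := by
      rcases Nat.eq_zero_or_pos m with h | h
      · rw [h, mul_zero, zero_add] at hp1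
        exact absurd hp1 hpp.one_lt.ne'
      · exact h
    have hMp : M < p := by
      have h1 : M ≤ ⌊D⌋₊ := Nat.le_floor hMD
      have h2 : d ≤ d * m := Nat.le_mul_of_pos_right _ hm0
      omega
    have hcop : Nat.Coprime p M := Nat.coprime_of_lt_prime hM.ne' hMp hpp
    by_cases hc : 3 / 2 * L < countDvd S (p - 1)
    · refine Finset.mem_union_left _ (Finset.mem_biUnion.2 ⟨(p - 1) % M, ?_, ?_⟩)
      · have h1 : (p - 1) % M + 1 ≡ p [MOD M] := by
          have := (Nat.mod_modEq (p - 1) M).add_right 1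
          rwa [Nat.sub_add_cancel hpp.one_le] at this
        refine Finset.mem_filter.2 ⟨Finset.mem_range.2 (Nat.mod_lt _ hM), ?_, ?_⟩
        · rw [Nat.coprime_iff_gcd_eq_one, h1.gcd_eq]
          exact hcop
        · rwa [countDvd_congr (Nat.mod_modEq (p - 1) M)]
      · refine Finset.mem_filter.2 ⟨hpx, hpp, ?_⟩
        have := ((Nat.mod_modEq (p - 1) M).add_right 1).symm
        rwa [Nat.sub_add_cancel hpp.one_le] at this
    · refine Finset.mem_union_right _ (Finset.mem_biUnion.2 ⟨(d % M, m % M), ?_, ?_⟩)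
      · have h1 : d % M * (m % M) ≡ d * m [MOD M] :=
          (Nat.mod_modEq d M).mul (Nat.mod_modEq m M)
        refine Finset.mem_filter.2 ⟨Finset.mem_product.2 ⟨Finset.mem_range.2 (Nat.mod_lt _ hM),
          Finset.mem_range.2 (Nat.mod_lt _ hM)⟩, ?_, ?_⟩
        · rw [Nat.coprime_iff_gcd_eq_one, (h1.add_right 1).gcd_eq, ← hp1]
          exact hcop
        · simp only
          rw [countDvd_congr h1, ← hm]
          exact not_lt.1 hc
      · refine Finset.mem_biUnion.2 ⟨d, Finset.mem_filter.2 ⟨hd, (Nat.mod_modEq d M).symm⟩,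
          Finset.mem_filter.2 ⟨hpx, hpp, ?_⟩⟩
        rw [hp1]
        exact ((Nat.mod_modEq m M).symm.mul_left' d).add_right 1
  have hA1 : ((G1.biUnion fun c => A M (c + 1)).card : ℝ) ≤
      400 * (x / Real.log x) * Real.exp (1 - 1 / 20 * L) := by
    calc ((G1.biUnion fun c => A M (c + 1)).card : ℝ)
        ≤ ∑ c ∈ G1, ((A M (c + 1)).card : ℝ) := by
          exact_mod_cast Finset.card_biUnion_le
      _ ≤ ∑ c ∈ G1, 400 * (x / Real.log x) * (1 / Nat.totient M) :=
          Finset.sum_le_sum fun c _ => card_primes_modEq_le_of_pow_le _ hM hx1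
            (hpow M (by nlinarith))
      _ = G1.card * (400 * (x / Real.log x) * (1 / Nat.totient M)) := by simp
      _ ≤ (Nat.totient M * Real.exp (1 - 1 / 20 * L)) *
          (400 * (x / Real.log x) * (1 / Nat.totient M)) := by gcongr
      _ = _ := by field_simp
  have hA2 : ((G2.biUnion fun t => (I t.1).biUnion fun d => A (d * M) (d * t.2 + 1)).card : ℝ) ≤
      21600 * (x / Real.log x) * Real.exp (1 - 1 / 20 * L) := by
    calc ((G2.biUnion fun t => (I t.1).biUnion fun d => A (d * M) (d * t.2 + 1)).card : ℝ)
        ≤ ∑ t ∈ G2, ∑ d ∈ I t.1, ((A (d * M) (d * t.2 + 1)).card : ℝ) := by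
          exact_mod_cast Finset.card_biUnion_le.trans
            (Finset.sum_le_sum fun t _ => Finset.card_biUnion_le)
      _ ≤ ∑ t ∈ G2, ∑ d ∈ I t.1, 400 * (x / Real.log x) * (1 / Nat.totient (d * M)) := by
          refine Finset.sum_le_sum fun t _ => Finset.sum_le_sum fun d hd => ?_
          have hd1 := Finset.mem_Ioc.1 (Finset.mem_filter.1 hd).1
          have hd8 : (d : ℝ) ≤ 8 * D := by
            refine le_trans ?_ (Nat.floor_le (show 0 ≤ 8 * D by linarith))
            exact_mod_cast hd1.2
          refine card_primes_modEq_le_of_pow_le _ (Nat.mul_pos (by omega) hM) hx1 (hpow _ ?_)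
          push_cast
          gcongr
      _ ≤ ∑ t ∈ G2, 400 * (x / Real.log x) * (54 / (M * Nat.totient M)) := by
          refine Finset.sum_le_sum fun t _ => ?_
          rw [← Finset.mul_sum]
          gcongr
          exact sum_one_div_totient_mul_le hM t.1 (by linarith) hDM
      _ = G2.card * (400 * (x / Real.log x) * (54 / (M * Nat.totient M))) := by simp
      _ ≤ (M * Nat.totient M * Real.exp (1 - 1 / 20 * L)) *
          (400 * (x / Real.log x) * (54 / (M * Nat.totient M))) := by gcongr
      _ = _ := by field_simp; norm_num
  have h1 : ((primesPredDvd x D).card : ℝ) ≤ ((G1.biUnion fun c => A M (c + 1)).card : ℝ) +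
      ((G2.biUnion fun t => (I t.1).biUnion fun d => A (d * M) (d * t.2 + 1)).card : ℝ) := by
    exact_mod_cast (Finset.card_le_card hcover).trans (Finset.card_union_le _ _)
  linarith

/-- Few primes `p` are such that `p - 1` has a divisor in `(D, 8 * D]`. -/
theorem eventually_card_primesPredDvd_le {ε : ℝ} (hε : 0 < ε) :
    ∀ᶠ D : ℝ in atTop, ∀ x, D ^ 2 ≤ x →
      ((primesPredDvd x D).card : ℝ) ≤ ε * (x / Real.log x) := by
  -- S depends on ε only, so M stays fixed as D grows; the bound is chosen so that 22000 exp(1 -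
  -- L/20) ≤ ε.
  obtain ⟨S, hS, hL⟩ := exists_finset_primes_sum_one_div_ge (20 * (1 - Real.log (ε / 22000)))
  have hM : 0 < ∏ p ∈ S, p := prod_primes_pos hS
  set M := ∏ p ∈ S, p with hMdef
  have hM' : (0 : ℝ) < M := by exact_mod_cast hM
  have h1 : ∀ᶠ D : ℝ in atTop, 1 + Real.log (8 * D) ≤ D / M := by
    have h2 := Real.isLittleO_log_id_atTop.bound (show (0 : ℝ) < 1 / (2 * M) by positivity)
    filter_upwards [h2, eventually_ge_atTop (2 * M * (1 + Real.log 8)), eventually_ge_atTop 1]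
      with D h3 h4 h5
    rw [Real.norm_of_nonneg (Real.log_nonneg h5), id, Real.norm_of_nonneg (by linarith)] at h3
    rw [Real.log_mul (by norm_num) (by linarith), le_div_iff₀ hM']
    have h6 : Real.log D * M ≤ 1 / (2 * M) * D * M := by gcongr
    have h7 : 1 / (2 * M) * D * M = D / 2 := by field_simp
    nlinarith
  filter_upwards [h1, eventually_ge_atTop (64 * (M : ℝ) ^ 2), eventually_ge_atTop 2]
    with D h3 h4 h5 x hx
  refine (card_primesPredDvd_le hS h4 hx h3).trans ?_
  have hlog : 0 < Real.log x := Real.log_pos (by nlinarith)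
  have hx0 : 0 < x := by nlinarith
  gcongr
  have h6 : Real.exp (1 - 1 / 20 * ∑ p ∈ S, (1 : ℝ) / p) ≤ ε / 22000 := by
    rw [← Real.exp_log (show 0 < ε / 22000 by positivity)]
    exact Real.exp_le_exp.2 (by linarith)
  linarith

/-! ### The exceptional primes are rare -/

/-- The primes `p ∈ (x / 2, x]` such that `p - 1` has a divisor in `(Q, 2 * Q]`. -/
noncomputable def exceptionalPrimes (x Q : ℝ) : Finset ℕ :=
  (upperHalfPrimes x).filter (fun p => ∃ q ∈ dyadicModuli Q, q ∣ p - 1)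

theorem lt_of_mem_upperHalfPrimes {x : ℝ} {p : ℕ} (hx : 0 ≤ x) (hp : p ∈ upperHalfPrimes x) :
    x / 2 < p ∧ (p : ℝ) ≤ x ∧ p.Prime := by
  simp only [upperHalfPrimes, Finset.mem_filter, Finset.mem_Ioc] at hp
  exact ⟨Nat.lt_of_floor_lt hp.1.1, (Nat.le_floor_iff hx).1 hp.1.2, hp.2⟩

theorem exceptionalPrimes_subset {x Q : ℝ} (hQ : 0 < Q) :
    exceptionalPrimes x Q ⊆ primesPredDvd x Q := by
  intro p hp
  obtain ⟨hp, q, hq, hqp⟩ := Finset.mem_filter.1 hp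
  obtain ⟨h1, h2⟩ := Finset.mem_filter.1 hp
  have hq := Finset.mem_Ioc.1 hq
  exact Finset.mem_filter.2 ⟨Finset.mem_Icc.2 ⟨h2.one_lt.le, (Finset.mem_Ioc.1 h1).2⟩, h2, q,
    Finset.mem_Ioc.2 ⟨hq.1, hq.2.trans (Nat.floor_le_floor (by linarith))⟩, hqp⟩

/-- If p - 1 = q * m with q ~ Q, then x/4 < p - 1 ≤ x places m in (x/(8Q), x/Q]. This is why the
windows (D, 8D] have ratio 8. -/
theorem exceptionalPrimes_subset_cofactor {x Q : ℝ} (hQ : 0 < Q) (hx : 4 ≤ x) :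
    exceptionalPrimes x Q ⊆ primesPredDvd x (x / (8 * Q)) := by
  intro p hp
  obtain ⟨hp, q, hq, m, hm⟩ := Finset.mem_filter.1 hp
  obtain ⟨h1, h2, h3⟩ := lt_of_mem_upperHalfPrimes (by linarith) hp
  have hq1 := Finset.mem_Ioc.1 hq
  have hqQ : Q < q := Nat.lt_of_floor_lt hq1.1
  have hq2 : (q : ℝ) ≤ 2 * Q := (Nat.le_floor_iff (by linarith)).1 hq1.2
  have hp1 : p = q * m + 1 := by
    have := h3.one_le
    omega
  have hp2 : (p : ℝ) = q * m + 1 := by exact_mod_cast hp1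
  refine Finset.mem_filter.2 ⟨Finset.mem_Icc.2 ⟨h3.one_lt.le, Nat.le_floor h2⟩, h3, m,
    Finset.mem_Ioc.2 ⟨?_, ?_⟩, Dvd.intro_left q hm.symm⟩
  · rw [Nat.floor_lt (by positivity), div_lt_iff₀ (by positivity)]
    have : (q : ℝ) * m ≤ 2 * Q * m := by gcongr
    linarith
  · refine Nat.le_floor ?_
    have h8 : 8 * (x / (8 * Q)) = x / Q := by field_simp
    rw [h8, le_div_iff₀ hQ]
    have : Q * (m : ℝ) ≤ q * m := by gcongr
    linarith

theorem exists_card_exceptionalPrimes_le {ε : ℝ} (hε : 0 < ε) :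
    ∃ T : ℝ, ∀ x Q : ℝ, T ≤ Q → T ≤ x / Q → 0 < Q →
      ((exceptionalPrimes x Q).card : ℝ) ≤ ε * (upperHalfPrimes x).card := by
  obtain ⟨D₀, hD₀⟩ := eventually_atTop.1
    (eventually_card_primesPredDvd_le (show 0 < ε / 24 by positivity))
  obtain ⟨x₀, hx₀⟩ := eventually_atTop.1 eventually_mul_div_log_le_card_upperHalfPrimes
  refine ⟨max (8 * D₀) (max x₀ 4), fun x Q hQ hxQ hQ0 => ?_⟩
  simp only [max_le_iff] at hQ hxQ
  have hx : x = x / Q * Q := by field_simp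
  have hxQ' : x / Q ≤ x := div_le_self (by nlinarith) (by linarith)
  have h1 : ((exceptionalPrimes x Q).card : ℝ) ≤ ε / 24 * (x / Real.log x) := by
    -- One of Q and x/(8Q) is at most √x, and both are at least `D₀`; use the divisor or its
    -- cofactor accordingly.
    by_cases hQx : Q ^ 2 ≤ x
    · refine le_trans ?_ (hD₀ Q (by linarith) x hQx)
      exact_mod_cast Finset.card_le_card (exceptionalPrimes_subset hQ0)
    · have h8 : x / (8 * Q) = x / Q / 8 := by field_simp
      refine le_trans ?_ (hD₀ (x / (8 * Q)) (by rw [h8]; linarith) x ?_)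
      · exact_mod_cast Finset.card_le_card (exceptionalPrimes_subset_cofactor hQ0 (by linarith))
      · rw [div_pow, div_le_iff₀ (by positivity)]
        nlinarith
  have h2 := hx₀ x (by linarith)
  calc _ ≤ ε * (x / Real.log x / 24) := by linarith
    _ ≤ _ := by gcongr

/-- The largest proportion of exceptional primes when both `Q` and `x / Q` are at least `t`. -/
noncomputable def exceptionalProportion (t : ℝ) : ℝ :=
  sSup {r : ℝ | ∃ x Q : ℝ, 0 < Q ∧ t ≤ min Q (x / Q) ∧
    r = ((exceptionalPrimes x Q).card : ℝ) / (upperHalfPrimes x).card}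

theorem card_exceptionalPrimes_div_le {x Q : ℝ} (hQ : 0 < Q) :
    ((exceptionalPrimes x Q).card : ℝ) / (upperHalfPrimes x).card ≤
      exceptionalProportion (min Q (x / Q)) := by
  refine le_csSup ⟨1, ?_⟩ ⟨x, Q, hQ, le_rfl, rfl⟩
  rintro r ⟨x, Q, -, -, rfl⟩
  -- If there are no primes in (x/2, x], the quotient is 0 by convention, so 1 still bounds the set.
  refine div_le_one_of_le₀ ?_ (by positivity)
  exact_mod_cast Finset.card_filter_le _ _

theorem tendsto_exceptionalProportion : Tendsto exceptionalProportion atTop (𝓝 0) := by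
  rw [Metric.tendsto_atTop]
  intro ε hε
  obtain ⟨T, hT⟩ := exists_card_exceptionalPrimes_le (half_pos hε)
  refine ⟨T, fun t ht => ?_⟩
  have h1 : exceptionalProportion t ≤ ε / 2 := by
    refine Real.sSup_le ?_ (by positivity)
    rintro r ⟨x, Q, hQ, htQ, rfl⟩
    rw [le_min_iff] at htQ
    exact div_le_of_le_mul₀ (by positivity) (by positivity)
      (hT x Q (ht.trans htQ.1) (ht.trans htQ.2) hQ)
  have h2 : 0 ≤ exceptionalProportion t := by
    refine Real.sSup_nonneg ?_
    rintro r ⟨x, Q, -, -, rfl⟩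
    positivity
  rw [Real.dist_eq, sub_zero, abs_of_nonneg h2]
  linarith

/-! ### The multiplicative modification of `g` -/

/-- The multiplicative function that takes the value `σ` at the elements of `P`, and agrees with `g`
at all other prime powers. -/
noncomputable def replaceAtPrimes (g : ArithmeticFunction ℂ) (P : Finset ℕ) (σ : ℂ) :
    ArithmeticFunction ℂ :=
  ⟨fun n => if n = 0 then 0 else
    n.factorization.prod fun p k => if p ∈ P ∧ k = 1 then σ else g (p ^ k), by simp⟩

theorem replaceAtPrimes_apply (g : ArithmeticFunction ℂ) (P : Finset ℕ) (σ : ℂ) {n : ℕ}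
    (hn : n ≠ 0) : replaceAtPrimes g P σ n =
      n.factorization.prod fun p k => if p ∈ P ∧ k = 1 then σ else g (p ^ k) :=
  if_neg hn

theorem isMultiplicative_replaceAtPrimes (g : ArithmeticFunction ℂ) (P : Finset ℕ) (σ : ℂ) :
    (replaceAtPrimes g P σ).IsMultiplicative := by
  rw [ArithmeticFunction.IsMultiplicative.iff_ne_zero]
  refine ⟨by simp [replaceAtPrimes_apply], fun {m n} hm hn h => ?_⟩
  rw [replaceAtPrimes_apply _ _ _ hm, replaceAtPrimes_apply _ _ _ hn,
    replaceAtPrimes_apply _ _ _ (mul_ne_zero hm hn), Nat.factorization_mul hm hn,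
    Finsupp.prod_add_index_of_disjoint]
  simpa using h.disjoint_primeFactors

theorem norm_replaceAtPrimes_le {g : ArithmeticFunction ℂ} (hg : ∀ n, ‖g n‖ ≤ 1) (P : Finset ℕ)
    {σ : ℂ} (hσ : ‖σ‖ ≤ 1) (n : ℕ) : ‖replaceAtPrimes g P σ n‖ ≤ 1 := by
  rcases eq_or_ne n 0 with rfl | hn
  · simp
  · rw [replaceAtPrimes_apply _ _ _ hn, Finsupp.prod, norm_prod]
    refine Finset.prod_le_one (fun _ _ => norm_nonneg _) fun p _ => ?_
    split_ifs
    · exact hσ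
    · exact hg _

theorem replaceAtPrimes_prime {g : ArithmeticFunction ℂ} (hg : g.IsMultiplicative) {P : Finset ℕ}
    (σ : ℂ) {p : ℕ} (hp : p.Prime) (hpP : p ∈ P) : replaceAtPrimes g P σ p = σ := by
  rw [replaceAtPrimes_apply _ _ _ hp.ne_zero, hp.factorization, Finsupp.prod_single_index]
  · simp [hpP]
  · simp [hg.map_one]

theorem replaceAtPrimes_of_not_dvd {g : ArithmeticFunction ℂ} (hg : g.IsMultiplicative)
    {P : Finset ℕ} (σ : ℂ) {n : ℕ} (hn : n ≠ 0) (h : ∀ p ∈ P, ¬ p ∣ n) :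
    replaceAtPrimes g P σ n = g n := by
  rw [replaceAtPrimes_apply _ _ _ hn, hg.multiplicative_factorization _ hn]
  refine Finsupp.prod_congr fun p hp => if_neg fun h1 => h p h1.1 ?_
  exact Nat.dvd_of_mem_primeFactors (by simpa using hp)

/-- A prime p > x/2 has no positive multiple up to x except itself, so changing the value at p
affects no other n ≤ x. -/
theorem agreesExceptOn_replaceAtPrimes {g : ArithmeticFunction ℂ} (hg : g.IsMultiplicative)
    {x : ℝ} (hx : 0 ≤ x) {P : Finset ℕ} (hP : P ⊆ upperHalfPrimes x) (σ : ℂ) :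
    AgreesExceptOn (replaceAtPrimes g P σ) g x P σ := by
  refine ⟨fun n hn hnx hnP => replaceAtPrimes_of_not_dvd hg σ (by omega) ?_, fun p hp =>
    replaceAtPrimes_prime hg σ (lt_of_mem_upperHalfPrimes hx (hP hp)).2.2 hp⟩
  rintro p hp ⟨k, rfl⟩
  have h1 := (lt_of_mem_upperHalfPrimes hx (hP hp)).1
  have hk : 2 ≤ k := by
    by_contra hk
    have : k = 0 ∨ k = 1 := by omega
    rcases this with rfl | rfl
    · simp at hn
    · exact hnP (by simpa using hp)
  have hk' : (2 : ℝ) ≤ k := by exact_mod_cast hk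
  push_cast at hnx
  nlinarith

/-! ### The discrepancy, the choice of sign, and the conclusion -/

theorem Delta_eq_add_mul {f g : ℕ → ℂ} {x : ℝ} (hx : 0 ≤ x) {P : Finset ℕ} {σ : ℂ}
    (h : AgreesExceptOn f g x P σ) (q : ℕ) (a : ℤ) :
    Delta f x q a = Delta (fun n => if n ∈ P then 0 else g n) x q a +
      σ * Delta (fun n => if n ∈ P then 1 else 0) x q a := by
  have h1 : ∀ n ∈ Finset.Icc 1 ⌊x⌋₊, f n =
      (if n ∈ P then 0 else g n) + σ * (if n ∈ P then 1 else 0) := by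
    intro n hn
    rw [Finset.mem_Icc] at hn
    by_cases hnP : n ∈ P
    · simp [hnP, h.2 n hnP]
    · simp [hnP, h.1 n hn.1 ((Nat.le_floor_iff hx).1 hn.2) hnP]
  have h2 : ∀ (r : ℕ → Prop) [DecidablePred r],
      ∑ n ∈ (Finset.Icc 1 ⌊x⌋₊).filter r, f n =
      ∑ n ∈ (Finset.Icc 1 ⌊x⌋₊).filter r, (if n ∈ P then 0 else g n) +
      σ * ∑ n ∈ (Finset.Icc 1 ⌊x⌋₊).filter r, (if n ∈ P then 1 else 0) := by
    intro r _
    rw [Finset.mul_sum, ← Finset.sum_add_distrib]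
    exact Finset.sum_congr rfl fun n hn => h1 n (Finset.mem_filter.1 hn).1
  unfold Delta
  rw [h2, h2]
  ring

/-- The sum over n ≡ 1 mod q is empty on P, so only the average term survives, and it counts all of
P. -/
theorem norm_Delta_indicator {x : ℝ} {P : Finset ℕ} {q : ℕ} (hP : P ⊆ Finset.Icc 1 ⌊x⌋₊)
    (h1 : ∀ p ∈ P, ¬ q ∣ p - 1) (h2 : ∀ p ∈ P, Nat.Coprime p q) :
    ‖Delta (fun n => if n ∈ P then 1 else 0) x q 1‖ = P.card / Nat.totient q := by
  have h3 : ∑ n ∈ (Finset.Icc 1 ⌊x⌋₊).filter (fun n : ℕ => (n : ℤ) ≡ 1 [ZMOD (q : ℤ)]),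
      (if n ∈ P then (1 : ℂ) else 0) = 0 := by
    refine Finset.sum_eq_zero fun n hn => if_neg fun hnP => h1 n hnP ?_
    obtain ⟨hn1, hn2⟩ := Finset.mem_filter.1 hn
    have : (n : ℤ) ≡ ((1 : ℕ) : ℤ) [ZMOD (q : ℤ)] := by exact_mod_cast hn2
    exact (Nat.modEq_iff_dvd' (Finset.mem_Icc.1 hn1).1).1 (Int.natCast_modEq_iff.1 this).symm
  have h4 : ∑ n ∈ (Finset.Icc 1 ⌊x⌋₊).filter (fun n : ℕ => Nat.Coprime n q),
      (if n ∈ P then (1 : ℂ) else 0) = P.card := by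
    rw [← Finset.sum_filter, Finset.sum_const, nsmul_eq_mul, mul_one]
    congr 2
    ext n
    simp only [Finset.mem_filter]
    exact ⟨fun h => h.2, fun h => ⟨⟨hP h, h2 n h⟩, h⟩⟩
  rw [Delta, h3, h4, zero_sub, norm_neg, norm_mul, norm_div, norm_one, Complex.norm_natCast,
    Complex.norm_natCast]
  ring

theorem norm_le_norm_add_or_sub (A B : ℂ) : ‖B‖ ≤ ‖A + B‖ ∨ ‖B‖ ≤ ‖A - B‖ := by
  by_contra! h
  have h1 : ‖(2 : ℂ) * B‖ ≤ ‖A + B‖ + ‖A - B‖ := by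
    have : (2 : ℂ) * B = (A + B) - (A - B) := by ring
    rw [this]
    exact norm_sub_le _ _
  rw [norm_mul, Complex.norm_ofNat] at h1
  linarith

theorem exists_sign_card_le_two_mul (s : Finset ℕ) (A B : ℕ → ℂ) :
    ∃ σ : ℂ, (σ = 1 ∨ σ = -1) ∧
      s.card ≤ 2 * (s.filter (fun q => ‖B q‖ ≤ ‖A q + σ * B q‖)).card := by
  have h1 : s ⊆ s.filter (fun q => ‖B q‖ ≤ ‖A q + 1 * B q‖) ∪
      s.filter (fun q => ‖B q‖ ≤ ‖A q + -1 * B q‖) := by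
    intro q hq
    rw [Finset.mem_union, Finset.mem_filter, Finset.mem_filter]
    rcases norm_le_norm_add_or_sub (A q) (B q) with h | h
    · exact Or.inl ⟨hq, by simpa using h⟩
    · exact Or.inr ⟨hq, by simpa [sub_eq_add_neg] using h⟩
  have h2 := (Finset.card_le_card h1).trans (Finset.card_union_le _ _)
  rcases le_total (s.filter (fun q => ‖B q‖ ≤ ‖A q + 1 * B q‖)).card
    (s.filter (fun q => ‖B q‖ ≤ ‖A q + -1 * B q‖)).card with h | h
  · exact ⟨-1, Or.inr rfl, by omega⟩
  · exact ⟨1, Or.inl rfl, by omega⟩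

theorem div_two_le_card_dyadicModuli {Q : ℝ} (hQ : 2 ≤ Q) :
    Q / 2 ≤ (dyadicModuli Q).card := by
  rw [dyadicModuli, Nat.card_Ioc, Nat.cast_sub (Nat.floor_le_floor (by linarith))]
  have h1 : (⌊Q⌋₊ : ℝ) ≤ Q := Nat.floor_le (by linarith)
  have h2 : 2 * Q < ⌊2 * Q⌋₊ + 1 := Nat.lt_floor_add_one _
  linarith

theorem proposition1p1 :
    ∃ c : ℝ, 0 < c ∧ ∃ T : ℝ, ∃ η : ℝ → ℝ, Tendsto η atTop (𝓝 0) ∧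
      ∀ g : ArithmeticFunction ℂ, g.IsMultiplicative → (∀ n : ℕ, ‖g n‖ ≤ 1) →
      ∀ x Q : ℝ, T ≤ Q → T ≤ x / Q → 0 < Q → Q ≤ x →
      ∃ P : Finset ℕ, P ⊆ upperHalfPrimes x ∧
        (1 - η (min Q (x / Q))) * ((upperHalfPrimes x).card : ℝ) ≤ (P.card : ℝ) ∧
        ∃ σ : ℂ, (σ = 1 ∨ σ = -1) ∧
          (∃ f : ArithmeticFunction ℂ, f.IsMultiplicative ∧ (∀ n : ℕ, ‖f n‖ ≤ 1) ∧
            AgreesExceptOn f g x P σ) ∧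
          ∀ f : ℕ → ℂ, AgreesExceptOn f g x P σ →
            (dyadicModuli Q).card ≤
              2 * ((dyadicModuli Q).filter (fun q : ℕ =>
                c * ((Nat.primeCounting ⌊x⌋₊ : ℝ) / (Nat.totient q : ℝ)) ≤
                  ‖Delta f x q 1‖)).card ∧
            c * (x / Real.log x) ≤ ∑ q ∈ dyadicModuli Q, ‖Delta f x q 1‖ := by
  obtain ⟨T, hT⟩ := exists_card_exceptionalPrimes_le (show (0 : ℝ) < 1 / 2 by norm_num)
  obtain ⟨x₀, hx₀⟩ := eventually_atTop.1 eventually_mul_div_log_le_card_upperHalfPrimes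
  -- 4800 = 48 * 100: at least half of the x/(24 log x) primes survive in P, and π(x) ≤ 100 x/log x.
  -- The 4 gives 4Q ≤ x, so that q ≤ 2Q ≤ x/2 < p.
  refine ⟨1 / 4800, by norm_num, max T (max x₀ 4), exceptionalProportion,
    tendsto_exceptionalProportion, fun g hg hg1 x Q hQ hxQ hQ0 hQx => ?_⟩
  simp only [max_le_iff] at hQ hxQ
  obtain ⟨hQT, hQx₀, hQ4⟩ := hQ
  obtain ⟨hxT, -, hx4⟩ := hxQ
  have hx0 : 0 ≤ x := by linarith
  have hxpos : 0 < x := by linarith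
  have hlog : 0 < Real.log x := Real.log_pos (by linarith)
  have hQx4 : 4 * Q ≤ x := by rwa [le_div_iff₀ hQ0] at hx4
  have hUH := hx₀ x (by linarith)
  have hbad := hT x Q hQT hxT hQ0
  set U := upperHalfPrimes x with hU
  set P := U.filter (fun p => ¬ ∃ q ∈ dyadicModuli Q, q ∣ p - 1) with hP
  have hPU : P ⊆ U := Finset.filter_subset _ _
  have hcard : (U.card : ℝ) = (exceptionalPrimes x Q).card + P.card := by
    exact_mod_cast (Finset.card_filter_add_card_filter_not (s := U)
      (fun p => ∃ q ∈ dyadicModuli Q, q ∣ p - 1)).symm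
  have hPcard : x / Real.log x / 48 ≤ P.card := by linarith
  let A : ℕ → ℂ := fun q => Delta (fun n => if n ∈ P then 0 else g n) x q 1
  let B : ℕ → ℂ := fun q => Delta (fun n => if n ∈ P then 1 else 0) x q 1
  have hmod : ∀ q ∈ dyadicModuli Q, 0 < q ∧ (q : ℝ) ≤ 2 * Q := by
    intro q hq
    have hq1 := Finset.mem_Ioc.1 hq
    exact ⟨by omega, (Nat.le_floor_iff (by linarith)).1 hq1.2⟩
  have hB : ∀ q ∈ dyadicModuli Q, ‖B q‖ = P.card / Nat.totient q := by
    intro q hq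
    obtain ⟨hq0, hq2⟩ := hmod q hq
    refine norm_Delta_indicator (fun p hp => ?_) (fun p hp hqp => ?_) fun p hp => ?_
    · have h1 := lt_of_mem_upperHalfPrimes hx0 (hPU hp)
      exact Finset.mem_Icc.2 ⟨h1.2.2.one_lt.le, Nat.le_floor h1.2.1⟩
    · exact (Finset.mem_filter.1 hp).2 ⟨q, hq, hqp⟩
    · have h1 := lt_of_mem_upperHalfPrimes hx0 (hPU hp)
      have h2 : (q : ℝ) < p := by linarith
      exact Nat.coprime_of_lt_prime hq0.ne' (by exact_mod_cast h2) h1.2.2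
  obtain ⟨σ, hσ, hσcard⟩ := exists_sign_card_le_two_mul (dyadicModuli Q) A B
  refine ⟨P, hPU, ?_, σ, hσ, ⟨replaceAtPrimes g P σ, isMultiplicative_replaceAtPrimes g P σ,
    norm_replaceAtPrimes_le hg1 P (by rcases hσ with rfl | rfl <;> simp),
    agreesExceptOn_replaceAtPrimes hg hx0 hPU σ⟩, fun f hf => ?_⟩
  · have hUpos : (0 : ℝ) < U.card := lt_of_lt_of_le (by positivity) hUH
    have h1 := (div_le_iff₀ hUpos).1 (card_exceptionalPrimes_div_le (x := x) hQ0)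
    linarith
  have hΔ : ∀ q, Delta f x q 1 = A q + σ * B q := fun q => Delta_eq_add_mul hx0 hf q 1
  simp_rw [hΔ]
  constructor
  · refine hσcard.trans (Nat.mul_le_mul_left 2 (Finset.card_le_card fun q hq => ?_))
    rw [Finset.mem_filter] at hq ⊢
    refine ⟨hq.1, le_trans ?_ hq.2⟩
    rw [hB q hq.1, ← mul_div_assoc]
    gcongr
    have := primeCounting_floor_le (show 1 < x by linarith)
    linarith
  · set G := (dyadicModuli Q).filter (fun q => ‖B q‖ ≤ ‖A q + σ * B q‖)
    have hG : Q / 4 ≤ G.card := by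
      have h1 := div_two_le_card_dyadicModuli (show 2 ≤ Q by linarith)
      have h2 : ((dyadicModuli Q).card : ℝ) ≤ 2 * G.card := by exact_mod_cast hσcard
      linarith
    -- At least Q/4 moduli are good, and each contributes at least |P|/φ(q) ≥ |P|/(2Q); this even
    -- gives the constant 1/384.
    calc 1 / 4800 * (x / Real.log x) ≤ Q / 4 * (x / Real.log x / 48 / (2 * Q)) := by
          have : Q / 4 * (x / Real.log x / 48 / (2 * Q)) = 1 / 384 * (x / Real.log x) := by
            field_simp
            ring
          rw [this]
          gcongr
          norm_num
      _ ≤ G.card * (P.card / (2 * Q)) := by gcongr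
      _ = ∑ q ∈ G, (P.card : ℝ) / (2 * Q) := by simp
      _ ≤ ∑ q ∈ G, ‖A q + σ * B q‖ := by
          refine Finset.sum_le_sum fun q hq => le_trans ?_ (Finset.mem_filter.1 hq).2
          have hq' := (Finset.mem_filter.1 hq).1
          obtain ⟨hq0, hq2⟩ := hmod q hq'
          rw [hB q hq']
          have h1 : (0 : ℝ) < Nat.totient q := by exact_mod_cast Nat.totient_pos.2 hq0
          gcongr
          refine le_trans ?_ hq2
          exact_mod_cast Nat.totient_le q
      _ ≤ _ := Finset.sum_le_sum_of_subset_of_nonneg (Finset.filter_subset _ _)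
          fun _ _ _ => norm_nonneg _
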